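/- Let $\mathbb S=\{x\in\mathbb H:\ \mathrm{Re}\,x=0,\ |x|=1\}$, let $i\in\mathbb S$ and $\alpha>-1$, and put $\mathbb C_i=\{u+iv: u,v\in\mathbb R\}$, $\mathbb D=\{x\in\mathbb H:|x|<1\}$, $\mathbb D_i=\mathbb D\cap\mathbb C_i$ and $dA_{\alpha,i}(z)=\frac{\alpha+1}{\pi}(1-|z|^2)^\alpha\,dm_i(z)$, where $m_i$ is Lebesgue measure on $\mathbb C_i$. A function $f:\mathbb D\to\mathbb H$ is left slice hyperholomorphic if it is real differentiable and $f(u+Iv)=a(u,v)+I\,b(u,v)$ for all $I\in\mathbb S$ and $u+Iv\in\mathbb D$, with $\mathbb H$-valued $a,b$ such that $a(u,-v)=a(u,v)$, $b(u,-v)=-b(u,v)$, $\partial_u a=\partial_v b$ and $\partial_u b=-\partial_v a$. Let $\mathcal A=\mathcal A^2_{\alpha,i}(\mathbb D)$ be the right $\mathbb H$-vector space of the left slice hyperholomorphic functions $f$ on $\mathbb D$ with $\|f\|^2=\int_{\mathbb D_i}|f|^2\,dA_{\alpha,i}<\infty$, with the scalar product $\langle f,g\rangle=\int_{\mathbb D_i}\overline{f(z)}g(z)\,dA_{\alpha,i}(z)$.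 For $f\in\mathcal A$ let $Jf\in\mathcal A$ be the unique left slice hyperholomorphic function on $\mathbb D$ that equals $z\mapsto i\,f(z)$ on $\mathbb D_i$, and let $\mathcal B_J(\mathcal A)$ be the set of all bounded right $\mathbb H$-linear operators $T$ on $\mathcal A$ with $TJ=JT$, with the operator norm $\|T\|=\sup_{\|f\|=1}\|Tf\|$. For $w\in\mathbb D_i$ let $K_w\in\mathcal A$ be the unique left slice hyperholomorphic function on $\mathbb D$ with $K_w(z)=(1-z\overline w)^{-(2+\alpha)}$ (principal branch in $\mathbb C_i$) for $z\in\mathbb D_i$, let $k_w=K_w/\|K_w\|$, and for $T\in\mathcal B_J(\mathcal A)$ let $\widetilde T(w)=\langle k_w,Tk_w\rangle$ be its Berezin transform. For $z,w\in\mathbb D_i$ let $\rho(z,w)=\frac{|z-w|}{|1-z\overline w|}$ be the pseudo-hyperbolic metric. Theorem. The functions $K_w$ are the reproducing kernels: $\langle K_w,f\rangle=f(w)$ for all $w\in\mathbb D_i$ and $f\in\mathcal A$. For every $T\in\mathcal B_J(\mathcal A)$, $$|\widetilde T(z)-\widetilde T(w)|\le 2\sqrt{2+\alpha}\,\|T\|\,\rho(z,w)\qquad\text{for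 all } z,w\in\mathbb D_i.$$ The Lipschitz constant $2\sqrt{2+\alpha}$ is sharp: if $C\in\mathbb R$ is such that $|\widetilde T(z)-\widetilde T(w)|\le C\,\|T\|\,\rho(z,w)$ for all $T\in\mathcal B_J(\mathcal A)$ and all $z,w\in\mathbb D_i$, then $C\ge 2\sqrt{2+\alpha}$. -/

import Mathlib

open scoped Quaternion

noncomputable section

namespace SliceBergman

/-- The sphere `𝕊` of imaginary units of `ℍ`. -/
abbrev ImaginaryUnit : Type := {x : ℍ // x.re = 0 ∧ ‖x‖ = 1}

theorem ImaginaryUnit.mul_self (i : ImaginaryUnit) : (i : ℍ) * (i : ℍ) = -1 := by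
  obtain ⟨x, h0, h1⟩ := i
  have h : Quaternion.normSq x = 1 := by
    rw [Quaternion.normSq_eq_norm_mul_self, h1, one_mul]
  rw [Quaternion.normSq_def'] at h
  ext
  · simp [h0]; nlinarith
  · simp [h0]; ring
  · simp [h0]; ring
  · simp [h0]; ring

/-- The embedding `u + 𝐢 v ↦ u + i v` of `ℂ` onto the plane `ℂ_i ⊆ ℍ`. -/
def plane (i : ImaginaryUnit) : ℂ →ₐ[ℝ] ℍ := Complex.liftAux (i : ℍ) i.mul_self

theorem plane_apply (i : ImaginaryUnit) (ζ : ℂ) :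
    plane i ζ = (ζ.re : ℍ) + ζ.im • (i : ℍ) := rfl

/-- The open unit ball `𝔻` of `ℍ`. -/
abbrev ball : Set ℍ := Metric.ball (0 : ℍ) 1

/-- `𝔻_i = 𝔻 ∩ ℂ_i`. -/
def sliceDisc (i : ImaginaryUnit) : Set ℍ := ball ∩ Set.range (plane i)

/-- The coordinate in `ℂ` of the orthogonal projection of `x` to `ℂ_i`; for `x ∈ ℂ_i` this
is the point `ζ` with `plane i ζ = x`. -/
def coord (i : ImaginaryUnit) (x : ℍ) : ℂ := ⟨x.re, inner ℝ (i : ℍ) x⟩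

/-- `f` is left slice hyperholomorphic on `U` (meant for axially symmetric open `U`): it is real
differentiable and `f (u + I v) = a (u, v) + I b (u, v)` for all imaginary units `I`, where `a` is
even and `b` is odd in `v`, and `∂a/∂u = ∂b/∂v` (`= p`), `∂b/∂u = -∂a/∂v` (`= q`). -/
def IsLeftSliceHyperholomorphicOn (f : ℍ → ℍ) (U : Set ℍ) : Prop :=
  DifferentiableOn ℝ f U ∧
    ∃ a b : ℝ → ℝ → ℍ, ∀ (I : ImaginaryUnit) (u v : ℝ), plane I ⟨u, v⟩ ∈ U →
      f (plane I ⟨u, v⟩) = a u v + (I : ℍ) * b u v ∧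
      a u (-v) = a u v ∧ b u (-v) = -b u v ∧
      ∃ p q : ℍ,
        HasDerivAt (fun s => a s v) p u ∧ HasDerivAt (fun t => b u t) p v ∧
        HasDerivAt (fun s => b s v) q u ∧ HasDerivAt (fun t => a u t) (-q) v

/-- The weighted area measure `(α + 1) / π * (1 - |z|²) ^ α dm(z)` on the unit disc. -/
def areaMeasure (α : ℝ) : MeasureTheory.Measure ℂ :=
  (MeasureTheory.volume.restrict (Metric.ball (0 : ℂ) 1)).withDensity
    fun z => ENNReal.ofReal ((α + 1) / Real.pi * (1 - ‖z‖ ^ 2) ^ α)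

/-- Extension by zero of a function on `𝔻`. -/
def extendZero (f : ball → ℍ) (x : ℍ) : ℍ :=
  open scoped Classical in if h : x ∈ ball then f ⟨x, h⟩ else 0

theorem extendZero_of_mem (f : ball → ℍ) {x : ℍ} (h : x ∈ ball) : extendZero f x = f ⟨x, h⟩ := by
  simp only [extendZero]
  exact dif_pos h

theorem extendZero_add (f g : ball → ℍ) : extendZero (f + g) = extendZero f + extendZero g := by
  funext x
  by_cases h : x ∈ ball <;> simp [extendZero, h]

theorem extendZero_smul (c : ℍᵐᵒᵖ) (f : ball → ℍ) :
    extendZero (c • f) = fun x => extendZero f x * c.unop := by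
  funext x
  by_cases h : x ∈ ball <;> simp [extendZero, h]

/-- The weighted slice Bergman space `𝒜²_{α,i}(𝔻)`, as a right vector space over `ℍ`. -/
def BergmanSpace (i : ImaginaryUnit) (α : ℝ) : Submodule ℍᵐᵒᵖ (ball → ℍ) where
  carrier := {f | IsLeftSliceHyperholomorphicOn (extendZero f) ball ∧
    MeasureTheory.MemLp (fun z : ℂ => extendZero f (plane i z)) 2 (areaMeasure α)}
  zero_mem' := by
    have h0 : extendZero (0 : ball → ℍ) = fun _ => 0 := by
      funext x
      by_cases h : x ∈ ball <;> simp [extendZero, h]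
    refine ⟨?_, ?_⟩
    · rw [h0]
      refine ⟨differentiableOn_const _, fun _ _ => 0, fun _ _ => 0, fun I u v _ => ?_⟩
      refine ⟨by simp, rfl, by simp, 0, 0, ?_⟩
      simp only [neg_zero]
      exact ⟨hasDerivAt_const _ _, hasDerivAt_const _ _, hasDerivAt_const _ _,
        hasDerivAt_const _ _⟩
    · simp [h0]
  add_mem' := by
    rintro f g ⟨⟨hfd, a, b, hf⟩, hfL⟩ ⟨⟨hgd, a', b', hg⟩, hgL⟩
    refine ⟨?_, ?_⟩
    · rw [extendZero_add]
      refine ⟨hfd.add hgd, fun u v => a u v + a' u v, fun u v => b u v + b' u v,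
        fun I u v h => ?_⟩
      obtain ⟨h1, h2, h3, p, q, h4, h5, h6, h7⟩ := hf I u v h
      obtain ⟨k1, k2, k3, p', q', k4, k5, k6, k7⟩ := hg I u v h
      refine ⟨?_, ?_, ?_, p + p', q + q', h4.add k4, h5.add k5, h6.add k6, ?_⟩
      · rw [Pi.add_apply, h1, k1, mul_add, add_add_add_comm]
      · simp only [h2, k2]
      · simp only [h3, k3]; abel
      · rw [neg_add]; exact h7.add k7
    · rw [extendZero_add]
      exact hfL.add hgL
  smul_mem' := by
    rintro c f ⟨⟨hfd, a, b, hf⟩, hfL⟩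
    refine ⟨?_, ?_⟩
    · rw [extendZero_smul]
      refine ⟨hfd.mul_const _, fun u v => a u v * c.unop, fun u v => b u v * c.unop,
        fun I u v h => ?_⟩
      obtain ⟨h1, h2, h3, p, q, h4, h5, h6, h7⟩ := hf I u v h
      refine ⟨?_, ?_, ?_, p * c.unop, q * c.unop, h4.mul_const _, h5.mul_const _,
        h6.mul_const _, ?_⟩
      · change extendZero f _ * _ = _
        rw [h1, add_mul, mul_assoc]
      · simp only [h2]
      · simp only [h3, neg_mul]
      · rw [← neg_mul]; exact h7.mul_const _
    · rw [extendZero_smul]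
      exact hfL.mul_const _

/-- The scalar product `∫_{𝔻_i} conj (f z) g z dA_{α,i}(z)`. -/
def scalarProduct {i : ImaginaryUnit} {α : ℝ} (f g : BergmanSpace i α) : ℍ :=
  ∫ z : ℂ, star (extendZero f (plane i z)) * extendZero g (plane i z) ∂(areaMeasure α)

/-- The norm `(∫_{𝔻_i} |f z|² dA_{α,i}(z)) ^ (1/2)`. -/
def bergmanNorm {i : ImaginaryUnit} {α : ℝ} (f : BergmanSpace i α) : ℝ :=
  Real.sqrt (∫ z : ℂ, ‖extendZero f (plane i z)‖ ^ 2 ∂(areaMeasure α))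

/-- The slice extension
`ext g (x₀ + i_x x₁) = ½ (1 - i_x i) g (x₀ + i x₁) + ½ (1 + i_x i) g (x₀ - i x₁)` of a function `g`
on `ℂ ≅ ℂ_i`, where `x₁ = |im x|` and `i_x = im x / |im x|` (for real `x` the two terms containing
`i_x` cancel, so that its value is irrelevant). -/
def sliceExt (i : ImaginaryUnit) (g : ℂ → ℍ) (x : ℍ) : ℍ :=
  (2⁻¹ : ℝ) • ((1 - (‖x.im‖⁻¹ • x.im) * (i : ℍ)) * g ⟨x.re, ‖x.im‖⟩) +
    (2⁻¹ : ℝ) • ((1 + (‖x.im‖⁻¹ • x.im) * (i : ℍ)) * g ⟨x.re, -‖x.im‖⟩)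

theorem sliceExt_plane (i I : ImaginaryUnit) (g : ℂ → ℍ) (u v : ℝ) :
    sliceExt i g (plane I ⟨u, v⟩) =
      (2⁻¹ : ℝ) • (g ⟨u, v⟩ + g ⟨u, -v⟩) +
        (I : ℍ) * ((2⁻¹ : ℝ) • (-((i : ℍ) * (g ⟨u, v⟩ - g ⟨u, -v⟩)))) := by
  have hre : (plane I ⟨u, v⟩).re = u := by simp [plane_apply, I.2.1]
  have him : (plane I ⟨u, v⟩).im = v • (I : ℍ) := by
    ext <;> simp [plane_apply, I.2.1]
  have hn : ‖(plane I ⟨u, v⟩).im‖ = |v| := by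
    rw [him, norm_smul, I.2.2, mul_one, Real.norm_eq_abs]
  rw [sliceExt, hre, hn, him]
  rcases lt_trichotomy v 0 with h | h | h
  · have h1 : (|v|⁻¹ • v • (I : ℍ)) = -(I : ℍ) := by
      rw [smul_smul, abs_of_neg h, inv_neg, neg_mul, inv_mul_cancel₀ h.ne, neg_one_smul]
    rw [h1, abs_of_neg h, neg_neg]
    simp only [mul_smul_comm, ← smul_add]
    congr 1
    noncomm_ring
  · subst h
    simp only [abs_zero, zero_smul, smul_zero, zero_mul, sub_zero, add_zero, neg_zero, one_mul,
      sub_self, mul_zero, smul_add]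
  · have h1 : (|v|⁻¹ • v • (I : ℍ)) = (I : ℍ) := by
      rw [smul_smul, abs_of_pos h, inv_mul_cancel₀ h.ne', one_smul]
    rw [h1, abs_of_pos h]
    simp only [mul_smul_comm, ← smul_add]
    congr 1
    noncomm_ring

theorem sliceExt_plane_self (i : ImaginaryUnit) (g : ℂ → ℍ) (ζ : ℂ) :
    sliceExt i g (plane i ζ) = g ζ := by
  obtain ⟨u, v⟩ := ζ
  rw [sliceExt_plane, mul_smul_comm, mul_neg, ← mul_assoc, i.mul_self, neg_one_mul, neg_neg,
    ← smul_add, add_add_sub_cancel, ← two_smul ℝ, smul_smul]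
  norm_num

theorem norm_plane (i : ImaginaryUnit) (ζ : ℂ) : ‖plane i ζ‖ = ‖ζ‖ := by
  have h : Quaternion.normSq (i : ℍ) = 1 := by
    rw [Quaternion.normSq_eq_norm_mul_self, i.2.2, one_mul]
  rw [Quaternion.normSq_def', i.2.1] at h
  have h2 : ‖plane i ζ‖ ^ 2 = ‖ζ‖ ^ 2 := by
    rw [sq, ← Quaternion.normSq_eq_norm_mul_self, Complex.sq_norm, Complex.normSq_apply,
      Quaternion.normSq_def']
    simp [plane_apply, i.2.1]
    linear_combination (ζ.im ^ 2) * h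
  exact (sq_eq_sq₀ (norm_nonneg _) (norm_nonneg _)).1 h2

theorem plane_mem_ball (i : ImaginaryUnit) (ζ : ℂ) : plane i ζ ∈ ball ↔ ‖ζ‖ < 1 := by
  rw [mem_ball_zero_iff, norm_plane]

/-- The real linear map `h ↦ h p` on `ℂ ≅ ℂ_i`. -/
def mulRight (i : ImaginaryUnit) (p : ℍ) : ℂ →L[ℝ] ℍ :=
  LinearMap.toContinuousLinearMap ((LinearMap.mulRight ℝ p).comp (plane i).toLinearMap)

theorem mulRight_apply (i : ImaginaryUnit) (p : ℍ) (h : ℂ) :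
    mulRight i p h = plane i h * p := rfl

/-- `g` is holomorphic on the unit disc with respect to multiplication by `i` from the left. -/
def IsHolomorphic (i : ImaginaryUnit) (g : ℂ → ℍ) : Prop :=
  ∀ ζ : ℂ, ‖ζ‖ < 1 → ∃ p : ℍ, HasFDerivAt g (mulRight i p) ζ

theorem norm_mk_neg (u v : ℝ) : ‖(⟨u, -v⟩ : ℂ)‖ = ‖(⟨u, v⟩ : ℂ)‖ :=
  Complex.norm_conj ⟨u, v⟩

theorem hasDerivAt_mk_left (u v : ℝ) : HasDerivAt (fun s : ℝ => (⟨s, v⟩ : ℂ)) 1 u := by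
  have h : (fun s : ℝ => (⟨s, v⟩ : ℂ)) = fun s : ℝ => (s : ℂ) + v * Complex.I := by
    funext s; exact Complex.mk_eq_add_mul_I s v
  rw [h]
  exact (Complex.ofRealCLM.hasDerivAt).add_const _

theorem hasDerivAt_mk_right (u v : ℝ) :
    HasDerivAt (fun t : ℝ => (⟨u, t⟩ : ℂ)) Complex.I v := by
  have h : (fun t : ℝ => (⟨u, t⟩ : ℂ)) = fun t : ℝ => (u : ℂ) + t * Complex.I := by
    funext s; exact Complex.mk_eq_add_mul_I u s
  rw [h]
  simpa using ((Complex.ofRealCLM.hasDerivAt (x := v)).mul_const Complex.I).const_add (u : ℂ)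

theorem differentiableAt_mk {x : ℍ} {r : ℍ → ℝ} (hr : DifferentiableAt ℝ r x) :
    DifferentiableAt ℝ (fun y : ℍ => (⟨y.re, r y⟩ : ℂ)) x := by
  have h : (fun y : ℍ => (⟨y.re, r y⟩ : ℂ)) =
      fun y : ℍ => ((inner ℝ y 1 : ℝ) : ℂ) + (r y : ℂ) * Complex.I := by
    funext y
    rw [Quaternion.inner_def, star_one, mul_one]
    exact Complex.mk_eq_add_mul_I _ _
  rw [h]
  have h1 : DifferentiableAt ℝ (fun y : ℍ => (inner ℝ y 1 : ℝ)) x :=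
    differentiableAt_id.inner ℝ (differentiableAt_const _)
  exact ((Complex.ofRealCLM.differentiableAt).comp x h1).add
    (((Complex.ofRealCLM.differentiableAt).comp x hr).mul_const _)

theorem differentiableAt_im (x : ℍ) : DifferentiableAt ℝ (fun y : ℍ => y.im) x := by
  have h : (fun y : ℍ => y.im) = fun y : ℍ => y - (inner ℝ y 1 : ℝ) • (1 : ℍ) := by
    funext y
    rw [Quaternion.inner_def, star_one, mul_one]
    ext <;> simp
  rw [h]
  exact differentiableAt_id.sub
    ((differentiableAt_id.inner ℝ (differentiableAt_const _)).smul_const _)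

theorem norm_mk_im (x : ℍ) : ‖(⟨x.re, ‖x.im‖⟩ : ℂ)‖ = ‖x‖ := by
  have h2 : ‖(⟨x.re, ‖x.im‖⟩ : ℂ)‖ ^ 2 = ‖x‖ ^ 2 := by
    rw [Complex.sq_norm, Complex.normSq_apply, ← Quaternion.normSq_eq_norm_mul_self, sq,
      ← Quaternion.normSq_eq_norm_mul_self, Quaternion.normSq_def', Quaternion.normSq_def']
    simp
    ring
  exact (sq_eq_sq₀ (norm_nonneg _) (norm_nonneg _)).1 h2

theorem norm_imUnit_le (x : ℍ) : ‖‖x.im‖⁻¹ • x.im‖ ≤ 1 := by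
  rw [norm_smul, norm_inv, norm_norm]
  exact inv_mul_le_one

theorem sliceExt_differentiableAt_of_ne (i : ImaginaryUnit) (g : ℂ → ℍ) (hg : IsHolomorphic i g)
    (x : ℍ) (hx : ‖x‖ < 1) (h0 : x.im ≠ 0) : DifferentiableAt ℝ (sliceExt i g) x := by
  have hn : DifferentiableAt ℝ (fun y : ℍ => ‖y.im‖) x := (differentiableAt_im x).norm ℝ h0
  have hu : DifferentiableAt ℝ (fun y : ℍ => ‖y.im‖⁻¹ • y.im) x :=
    (hn.inv (norm_ne_zero_iff.2 h0)).smul (differentiableAt_im x)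
  obtain ⟨p, hp⟩ := hg ⟨x.re, ‖x.im‖⟩ (by rwa [norm_mk_im])
  obtain ⟨q, hq⟩ := hg ⟨x.re, -‖x.im‖⟩ (by rwa [norm_mk_neg, norm_mk_im])
  have h1 : DifferentiableAt ℝ (fun y : ℍ => g ⟨y.re, ‖y.im‖⟩) x :=
    DifferentiableAt.comp (g := g) x hp.differentiableAt (differentiableAt_mk hn)
  have h2 : DifferentiableAt ℝ (fun y : ℍ => g ⟨y.re, -‖y.im‖⟩) x :=
    DifferentiableAt.comp (g := g) x hq.differentiableAt (differentiableAt_mk hn.neg)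
  unfold sliceExt
  exact ((((hu.mul_const _).const_sub 1).mul h1).const_smul (2⁻¹ : ℝ)).add
    ((((hu.mul_const _).const_add 1).mul h2).const_smul (2⁻¹ : ℝ))

theorem sliceExt_differentiableAt_of_eq (i : ImaginaryUnit) (g : ℂ → ℍ) (hg : IsHolomorphic i g)
    (x : ℍ) (hx : ‖x‖ < 1) (h0 : x.im = 0) : DifferentiableAt ℝ (sliceExt i g) x := by
  have hζ : (⟨x.re, 0⟩ : ℂ) = ⟨x.re, ‖x.im‖⟩ := by rw [h0, norm_zero]
  obtain ⟨p, hp⟩ := hg ⟨x.re, 0⟩ (by rw [hζ]; rwa [norm_mk_im])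
  have hx0 : sliceExt i g x = g ⟨x.re, 0⟩ := by
    rw [sliceExt, h0, norm_zero, neg_zero, smul_zero, zero_mul, sub_zero, add_zero, one_mul,
      ← two_smul ℝ, smul_smul]
    norm_num
  have key : ∀ σ : ℝ, |σ| = 1 →
      (fun y : ℍ => g ⟨y.re, σ * ‖y.im‖⟩ - g ⟨x.re, 0⟩ -
        mulRight i p ((⟨y.re, σ * ‖y.im‖⟩ : ℂ) - ⟨x.re, 0⟩)) =o[nhds x] fun y => y - x := by
    intro σ hσ
    have hnorm : ∀ y : ℍ, ‖(⟨y.re, σ * ‖y.im‖⟩ : ℂ) - ⟨x.re, 0⟩‖ = ‖y - x‖ := by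
      intro y
      have h2 : ‖(⟨y.re, σ * ‖y.im‖⟩ : ℂ) - ⟨x.re, 0⟩‖ ^ 2 = ‖y - x‖ ^ 2 := by
        have e1 : (y - x).im = y.im := by
          rw [Quaternion.im_sub, h0, sub_zero]
        rw [← norm_mk_im (y - x), e1, Complex.sq_norm, Complex.sq_norm, Complex.normSq_apply,
          Complex.normSq_apply]
        have e2 : σ * σ = 1 := by rw [← abs_mul_abs_self, hσ, one_mul]
        simp
        linear_combination (‖y.im‖ ^ 2) * e2
      exact (sq_eq_sq₀ (norm_nonneg _) (norm_nonneg _)).1 h2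
    have ht : Filter.Tendsto (fun y : ℍ => (⟨y.re, σ * ‖y.im‖⟩ : ℂ)) (nhds x)
        (nhds ⟨x.re, 0⟩) := by
      rw [tendsto_iff_norm_sub_tendsto_zero]
      simp only [hnorm]
      exact tendsto_iff_norm_sub_tendsto_zero.1 Filter.tendsto_id
    have h3 := hp.isLittleO.comp_tendsto ht
    exact h3.trans_isBigO (Asymptotics.isBigO_of_le _ fun y => (hnorm y).le)
  have k1 := key 1 abs_one
  have k2 := key (-1) (by simp)
  have hb : ∀ s : ℍ, ‖s‖ ≤ 1 → ‖(2⁻¹ : ℝ) • (1 - s)‖ ≤ 1 := by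
    intro s hs
    rw [norm_smul, norm_inv, Real.norm_ofNat]
    have := norm_sub_le (1 : ℍ) s
    rw [norm_one] at this
    linarith
  have hι : ∀ y : ℍ, ‖(‖y.im‖⁻¹ • y.im) * (i : ℍ)‖ ≤ 1 := fun y => by
    rw [norm_mul, i.2.2, mul_one]; exact norm_imUnit_le y
  have b1 : (fun y : ℍ => (2⁻¹ : ℝ) • (1 - (‖y.im‖⁻¹ • y.im) * (i : ℍ))) =O[nhds x]
      fun _ => (1 : ℝ) :=
    Asymptotics.isBigO_of_le _ fun y => by
      rw [norm_one]; exact hb _ (hι y)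
  have b2 : (fun y : ℍ => (2⁻¹ : ℝ) • (1 - -((‖y.im‖⁻¹ • y.im) * (i : ℍ)))) =O[nhds x]
      fun _ => (1 : ℝ) :=
    Asymptotics.isBigO_of_le _ fun y => by
      rw [norm_one]; exact hb _ (by rw [norm_neg]; exact hι y)
  have t1 := b1.mul_isLittleO k1.norm_right
  have t2 := b2.mul_isLittleO k2.norm_right
  have t := t1.add t2
  simp only [one_mul] at t
  have hd : HasFDerivAt (sliceExt i g)
      (LinearMap.toContinuousLinearMap (LinearMap.mulRight ℝ p : ℍ →ₗ[ℝ] ℍ)) x := by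
    refine HasFDerivAt.of_isLittleO (t.of_norm_right.congr_left fun y => ?_)
    have hs : ‖y.im‖ • (‖y.im‖⁻¹ • y.im) = y.im := by
      rcases eq_or_ne y.im 0 with h | h
      · rw [h, smul_zero, smul_zero]
      · rw [smul_smul, mul_inv_cancel₀ (norm_ne_zero_iff.2 h), one_smul]
    have hyx : y - x = ((y.re - x.re : ℝ) : ℍ) + ‖y.im‖ • (‖y.im‖⁻¹ • y.im) := by
      rw [hs]
      have hxx : x = (x.re : ℍ) := by
        conv_lhs => rw [← Quaternion.re_add_im x, h0, add_zero]
      conv_lhs => rw [hxx, ← Quaternion.re_add_im y]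
      rw [Quaternion.coe_sub]
      abel
    have hp1 : ∀ σ : ℝ, plane i ((⟨y.re, σ⟩ : ℂ) - ⟨x.re, 0⟩) =
        ((y.re - x.re : ℝ) : ℍ) + σ • (i : ℍ) := by
      intro σ
      rw [plane_apply, Complex.sub_re, Complex.sub_im, sub_zero]
    have hr : (LinearMap.toContinuousLinearMap (LinearMap.mulRight ℝ p : ℍ →ₗ[ℝ] ℍ)) (y - x) =
      (y - x) * p := rfl
    have hii := i.mul_self
    rw [hr, hyx, mulRight_apply, mulRight_apply, hp1, hp1, hx0, sliceExt]
    simp only [neg_one_mul, neg_smul]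
    generalize ‖y.im‖⁻¹ • y.im = s
    generalize ((y.re - x.re : ℝ) : ℍ) = h
    generalize ‖y.im‖ = n
    generalize g ⟨y.re, n⟩ = A
    generalize g ⟨y.re, -n⟩ = B
    have e : s * (i : ℍ) * (n • (i : ℍ) * p) = -(n • s * p) := by
      rw [smul_mul_assoc, mul_smul_comm, mul_assoc, ← mul_assoc (i : ℍ), hii, neg_one_mul, mul_neg,
        smul_neg, smul_mul_assoc]
    simp only [smul_mul_assoc (2⁻¹ : ℝ), mul_sub, sub_mul, add_mul, mul_add, one_mul, neg_mul,
      mul_neg, e]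
    module
  exact hd.differentiableAt

/-- The slice extension of a holomorphic function is left slice hyperholomorphic. -/
theorem sliceExt_isLeftSliceHyperholomorphicOn (i : ImaginaryUnit) (g : ℂ → ℍ)
    (hg : IsHolomorphic i g) : IsLeftSliceHyperholomorphicOn (sliceExt i g) ball := by
  refine ⟨fun x hx => ?_, fun u v => (2⁻¹ : ℝ) • (g ⟨u, v⟩ + g ⟨u, -v⟩),
    fun u v => (2⁻¹ : ℝ) • (-((i : ℍ) * (g ⟨u, v⟩ - g ⟨u, -v⟩))), fun I u v h => ?_⟩
  · rw [mem_ball_zero_iff] at hx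
    by_cases h0 : x.im = 0
    · exact (sliceExt_differentiableAt_of_eq i g hg x hx h0).differentiableWithinAt
    · exact (sliceExt_differentiableAt_of_ne i g hg x hx h0).differentiableWithinAt
  · rw [plane_mem_ball] at h
    obtain ⟨p, hp⟩ := hg ⟨u, v⟩ h
    obtain ⟨q, hq⟩ := hg ⟨u, -v⟩ (by rwa [norm_mk_neg])
    have e1 : mulRight i p 1 = p := by rw [mulRight_apply, map_one, one_mul]
    have e2 : mulRight i q 1 = q := by rw [mulRight_apply, map_one, one_mul]
    have pI : plane i Complex.I = (i : ℍ) := by simp [plane_apply]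
    have e3 : mulRight i p Complex.I = (i : ℍ) * p := by rw [mulRight_apply, pI]
    have e4 : mulRight i q (-Complex.I) = -((i : ℍ) * q) := by
      rw [mulRight_apply, map_neg, pI, neg_mul]
    have d1 : HasDerivAt (fun s : ℝ => g ⟨s, v⟩) p u := by
      have := hp.comp_hasDerivAt u (hasDerivAt_mk_left u v)
      rwa [e1] at this
    have d2 : HasDerivAt (fun s : ℝ => g ⟨s, -v⟩) q u := by
      have := hq.comp_hasDerivAt u (hasDerivAt_mk_left u (-v))
      rwa [e2] at this
    have d3 : HasDerivAt (fun t : ℝ => g ⟨u, t⟩) ((i : ℍ) * p) v := by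
      have := hp.comp_hasDerivAt v (hasDerivAt_mk_right u v)
      rwa [e3] at this
    have d4 : HasDerivAt (fun t : ℝ => g ⟨u, -t⟩) (-((i : ℍ) * q)) v := by
      have hn : HasDerivAt (fun t : ℝ => (⟨u, -t⟩ : ℂ)) (-Complex.I) v := by
        have := (hasDerivAt_mk_right u (-v)).scomp v (hasDerivAt_neg v)
        rwa [neg_one_smul] at this
      have := hq.comp_hasDerivAt v hn
      rwa [e4] at this
    have hii := i.mul_self
    refine ⟨sliceExt_plane i I g u v, ?_, ?_, (2⁻¹ : ℝ) • (p + q),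
      (2⁻¹ : ℝ) • (-((i : ℍ) * (p - q))), (d1.add d2).const_smul (2⁻¹ : ℝ), ?_,
      (((d1.sub d2).const_mul (i : ℍ)).neg).const_smul (2⁻¹ : ℝ), ?_⟩
    · simp only [neg_neg]
      rw [add_comm]
    · simp only [neg_neg]
      rw [← smul_neg, ← neg_sub (g ⟨u, v⟩), mul_neg]
    · have := ((d3.sub d4).const_mul (i : ℍ)).neg.const_smul (2⁻¹ : ℝ)
      refine this.congr_deriv ?_
      rw [sub_neg_eq_add, ← mul_add, ← mul_assoc, hii, neg_one_mul, neg_neg]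
    · have := (d3.add d4).const_smul (2⁻¹ : ℝ)
      refine this.congr_deriv ?_
      rw [smul_neg, neg_neg, mul_sub, sub_eq_add_neg]

theorem IsLeftSliceHyperholomorphicOn.congr {f g : ℍ → ℍ} {U : Set ℍ}
    (hf : IsLeftSliceHyperholomorphicOn f U) (h : ∀ x ∈ U, g x = f x) :
    IsLeftSliceHyperholomorphicOn g U := by
  obtain ⟨hd, a, b, hab⟩ := hf
  refine ⟨hd.congr h, a, b, fun I u v hU => ?_⟩
  rw [h _ hU]
  exact hab I u v hU

/-- The function on `𝔻` that extends `g`, as an element of the Bergman space. -/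
def ofSlice {i : ImaginaryUnit} {α : ℝ} (g : ℂ → ℍ) (hg : IsHolomorphic i g)
    (hL : MeasureTheory.MemLp g 2 (areaMeasure α)) : BergmanSpace i α :=
  ⟨fun x => sliceExt i g x, by
    have he : ∀ x ∈ ball, extendZero (fun x => sliceExt i g x) x = sliceExt i g x :=
      fun x hx => extendZero_of_mem _ hx
    refine ⟨(sliceExt_isLeftSliceHyperholomorphicOn i g hg).congr he, ?_⟩
    refine (MeasureTheory.memLp_congr_ae ?_).2 hL
    refine (MeasureTheory.withDensity_absolutelyContinuous _ _).ae_le ?_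
    filter_upwards [MeasureTheory.ae_restrict_mem measurableSet_ball] with z hz
    rw [he _ ((plane_mem_ball i z).2 (mem_ball_zero_iff.1 hz)), sliceExt_plane_self]⟩

theorem hasFDerivAt_plane (i : ImaginaryUnit) (ζ : ℂ) :
    HasFDerivAt (plane i) (mulRight i 1) ζ := by
  have h : (plane i : ℂ → ℍ) = mulRight i 1 := by
    funext z; rw [mulRight_apply, mul_one]
  rw [h]
  exact (mulRight i 1).hasFDerivAt

theorem isHolomorphic_of_mem {i : ImaginaryUnit} {α : ℝ} (f : BergmanSpace i α) :
    IsHolomorphic i fun ζ => (i : ℍ) * extendZero f (plane i ζ) := by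
  obtain ⟨f, ⟨hd, a, b, hab⟩, hL⟩ := f
  intro ζ hζ
  obtain ⟨u, v⟩ := ζ
  have hb := (plane_mem_ball i ⟨u, v⟩).2 hζ
  obtain ⟨h1, h2, h3, p, q, h4, h5, h6, h7⟩ := hab i u v hb
  have hdf := (hd.differentiableAt (Metric.isOpen_ball.mem_nhds hb)).hasFDerivAt
  have hg : HasFDerivAt (fun ζ => extendZero f (plane i ζ)) _ (⟨u, v⟩ : ℂ) :=
    hdf.comp _ (hasFDerivAt_plane i ⟨u, v⟩)
  set L := (fderiv ℝ (extendZero f) (plane i ⟨u, v⟩)).comp (mulRight i 1) with hLdef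
  have o1 : ∀ᶠ s : ℝ in nhds u, ‖(⟨s, v⟩ : ℂ)‖ < 1 :=
    ((hasDerivAt_mk_left u v).continuousAt.norm).eventually_lt continuousAt_const hζ
  have o2 : ∀ᶠ t : ℝ in nhds v, ‖(⟨u, t⟩ : ℂ)‖ < 1 :=
    ((hasDerivAt_mk_right u v).continuousAt.norm).eventually_lt continuousAt_const hζ
  have c1 : HasDerivAt (fun s : ℝ => extendZero f (plane i ⟨s, v⟩)) (L 1) u :=
    HasFDerivAt.comp_hasDerivAt (l := fun ζ => extendZero f (plane i ζ)) u hg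
      (hasDerivAt_mk_left u v)
  have c2 : HasDerivAt (fun t : ℝ => extendZero f (plane i ⟨u, t⟩)) (L Complex.I) v :=
    HasFDerivAt.comp_hasDerivAt (l := fun ζ => extendZero f (plane i ζ)) v hg
      (hasDerivAt_mk_right u v)
  have c3 : HasDerivAt (fun s : ℝ => extendZero f (plane i ⟨s, v⟩)) (p + (i : ℍ) * q) u := by
    refine (h4.add (h6.const_mul (i : ℍ))).congr_of_eventuallyEq ?_
    filter_upwards [o1] with s hs
    exact (hab i s v ((plane_mem_ball i _).2 hs)).1
  have c4 : HasDerivAt (fun t : ℝ => extendZero f (plane i ⟨u, t⟩)) (-q + (i : ℍ) * p) v := by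
    refine (h7.add (h5.const_mul (i : ℍ))).congr_of_eventuallyEq ?_
    filter_upwards [o2] with t ht
    exact (hab i u t ((plane_mem_ball i _).2 ht)).1
  have l1 := c1.unique c3
  have l2 := c2.unique c4
  have hii := i.mul_self
  refine ⟨(i : ℍ) * (p + (i : ℍ) * q), ?_⟩
  have hm := hg.const_mul (i : ℍ)
  refine hm.congr_fderiv (ContinuousLinearMap.ext fun h => Eq.symm ?_)
  have hh : h = h.re • (1 : ℂ) + h.im • Complex.I := by
    rw [Complex.real_smul, Complex.real_smul, mul_one, Complex.re_add_im]
  change plane i h * ((i : ℍ) * (p + (i : ℍ) * q)) = (i : ℍ) * L h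
  have hLh : L h = h.re • (p + (i : ℍ) * q) + h.im • (-q + (i : ℍ) * p) := by
    conv_lhs => rw [hh]
    rw [map_add, map_smul, map_smul, l1, l2]
  have hph : plane i h = h.re • (1 : ℍ) + h.im • (i : ℍ) := by
    have h1 : (h.re : ℍ) = h.re • (1 : ℍ) := by rw [← Quaternion.coe_mul_eq_smul, mul_one]
    rw [plane_apply, h1]
  rw [hLh, hph]
  have hiq : (i : ℍ) * ((i : ℍ) * q) = -q := by rw [← mul_assoc, hii, neg_one_mul]
  have hip : (i : ℍ) * ((i : ℍ) * p) = -p := by rw [← mul_assoc, hii, neg_one_mul]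
  simp only [mul_add, add_mul, smul_mul_assoc, mul_smul_comm, one_mul, hiq, hip, mul_neg]
  module

/-- The unitary anti-selfadjoint operator `J f = ext (i f_i)` on `𝒜²_{α,i}(𝔻)`. -/
def J {i : ImaginaryUnit} {α : ℝ} (f : BergmanSpace i α) : BergmanSpace i α :=
  ofSlice (fun ζ => (i : ℍ) * extendZero f (plane i ζ)) (isHolomorphic_of_mem f)
    (f.2.2.const_mul (i : ℍ))

/-- `ℬ_J(𝒜²_{α,i}(𝔻))`: the bounded right linear operators that commute with `J`. -/
def commutantJ (i : ImaginaryUnit) (α : ℝ) :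
    Set (BergmanSpace i α →ₗ[ℍᵐᵒᵖ] BergmanSpace i α) :=
  {T | (∃ C : ℝ, ∀ f, bergmanNorm (T f) ≤ C * bergmanNorm f) ∧ ∀ f, T (J f) = J (T f)}

/-- The operator norm `sup {‖T f‖ : ‖f‖ = 1}`. -/
def operatorNorm {i : ImaginaryUnit} {α : ℝ} (T : BergmanSpace i α →ₗ[ℍᵐᵒᵖ] BergmanSpace i α) :
    ℝ :=
  sSup {r : ℝ | ∃ f : BergmanSpace i α, bergmanNorm f = 1 ∧ r = bergmanNorm (T f)}

theorem isFiniteMeasure_areaMeasure {α : ℝ} (hα : -1 < α) :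
    MeasureTheory.IsFiniteMeasure (areaMeasure α) := by
  have h1 : MeasureTheory.IntegrableOn (fun y : ℝ => y * (1 - y ^ 2) ^ α) (Set.Ioc 0 1) := by
    have hd : ∀ y ∈ Set.Ioo (0 : ℝ) 1,
        HasDerivAt (fun y : ℝ => -(1 - y ^ 2) ^ (α + 1) / (2 * (α + 1)))
          (y * (1 - y ^ 2) ^ α) y := by
      intro y hy
      have hpos : 0 < 1 - y ^ 2 := by nlinarith [hy.1, hy.2]
      have h := ((((hasDerivAt_id y).pow 2).const_sub 1).rpow_const (p := α + 1)
        (Or.inl hpos.ne')).neg.div_const (2 * (α + 1))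
      refine h.congr_deriv ?_
      have : α + 1 ≠ 0 := by linarith
      simp
      field_simp
    refine intervalIntegral.integrableOn_deriv_of_nonneg ?_ hd ?_
    · refine ContinuousOn.div_const (ContinuousOn.neg ?_) _
      exact ContinuousOn.rpow_const (by fun_prop) fun y _ => Or.inr (by linarith)
    · intro y hy
      have hpos : 0 < 1 - y ^ 2 := by nlinarith [hy.1, hy.2]
      exact mul_nonneg hy.1.le (Real.rpow_nonneg hpos.le _)
  have h2 : MeasureTheory.Integrable
      (fun z : ℂ => (Set.Iio (1 : ℝ)).indicator (fun y => (1 - y ^ 2) ^ α) ‖z‖) := by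
    refine (MeasureTheory.integrable_fun_norm_addHaar MeasureTheory.volume
      (f := (Set.Iio (1 : ℝ)).indicator (fun y => (1 - y ^ 2) ^ α))).2 ?_
    rw [Complex.finrank_real_complex]
    have e : (fun y : ℝ => y ^ (2 - 1) • (Set.Iio (1 : ℝ)).indicator
        (fun y => (1 - y ^ 2) ^ α) y) =
        (Set.Iio (1 : ℝ)).indicator fun y => y * (1 - y ^ 2) ^ α := by
      funext y
      by_cases h : y ∈ Set.Iio (1 : ℝ) <;> simp [h]
    rw [e, ← MeasureTheory.integrable_indicator_iff measurableSet_Ioi, Set.indicator_indicator,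
      MeasureTheory.integrable_indicator_iff (measurableSet_Ioi.inter measurableSet_Iio)]
    exact h1.mono_set fun y hy => ⟨hy.1, le_of_lt hy.2⟩
  have h3 : MeasureTheory.Integrable
      (fun z : ℂ => (α + 1) / Real.pi * (1 - ‖z‖ ^ 2) ^ α)
      (MeasureTheory.volume.restrict (Metric.ball (0 : ℂ) 1)) := by
    refine MeasureTheory.Integrable.const_mul ?_ _
    refine (h2.restrict (s := Metric.ball (0 : ℂ) 1)).congr ?_
    filter_upwards [MeasureTheory.ae_restrict_mem measurableSet_ball] with z hz
    have hz' : ‖z‖ ∈ Set.Iio (1 : ℝ) := mem_ball_zero_iff.1 hz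
    rw [Set.indicator_of_mem hz']
  exact MeasureTheory.isFiniteMeasure_withDensity_ofReal h3.2

/-- The complex Bergman kernel `(1 - z conj(w)) ^ (-(2 + α))`. -/
def complexKernel (α : ℝ) (z w : ℂ) : ℂ :=
  1 / (1 - z * (starRingEnd ℂ) w) ^ ((2 + α : ℝ) : ℂ)

theorem norm_coord_lt {i : ImaginaryUnit} (w : sliceDisc i) : ‖coord i w‖ < 1 := by
  obtain ⟨w, hw, ζ, rfl⟩ := w
  have h : coord i (plane i ζ) = ζ := by
    have hi := i.2.1
    have hn : inner ℝ (i : ℍ) (i : ℍ) = (1 : ℝ) := by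
      rw [real_inner_self_eq_norm_sq, i.2.2, one_pow]
    have h1 : inner ℝ (i : ℍ) ((ζ.re : ℝ) : ℍ) = (0 : ℝ) := by
      rw [Quaternion.inner_def]; simp [hi]
    apply Complex.ext
    · simp [coord, plane_apply, hi]
    · simp only [coord, plane_apply]
      rw [inner_add_right, inner_smul_right, hn, h1]; simp
  simp only [h]
  exact (plane_mem_ball i ζ).1 hw

theorem kernel_base {z w : ℂ} (hz : ‖z‖ < 1) (hw : ‖w‖ < 1) :
    0 < (1 - z * (starRingEnd ℂ) w).re := by
  have h := Complex.re_le_norm (z * (starRingEnd ℂ) w)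
  rw [norm_mul, Complex.norm_conj] at h
  rw [Complex.sub_re, Complex.one_re]
  nlinarith [norm_nonneg z, norm_nonneg w]

theorem kernel_isHolomorphic (i : ImaginaryUnit) (α : ℝ) {w : ℂ} (hw : ‖w‖ < 1) :
    IsHolomorphic i fun ζ => plane i (complexKernel α ζ w) := by
  intro ζ hζ
  have hpos := kernel_base hζ hw
  have hd : DifferentiableAt ℂ (fun ζ => complexKernel α ζ w) ζ := by
    unfold complexKernel
    have hb : DifferentiableAt ℂ (fun z : ℂ => 1 - z * (starRingEnd ℂ) w) ζ := by fun_prop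
    refine (differentiableAt_const _).div (hb.cpow_const (Or.inl hpos)) ?_
    rw [Ne, Complex.cpow_eq_zero_iff]
    rintro ⟨h, -⟩
    rw [h] at hpos
    exact lt_irrefl _ hpos
  have hr := hd.hasDerivAt.hasFDerivAt.restrictScalars ℝ
  refine ⟨plane i (deriv (fun ζ => complexKernel α ζ w) ζ), ?_⟩
  have hc : HasFDerivAt (fun ζ => plane i (complexKernel α ζ w)) _ ζ :=
    (hasFDerivAt_plane i _).comp ζ hr
  refine hc.congr_fderiv (ContinuousLinearMap.ext fun h => ?_)
  simp [mulRight_apply]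

theorem kernel_memLp (i : ImaginaryUnit) {α : ℝ} (hα : -1 < α) {w : ℂ} (hw : ‖w‖ < 1) :
    MeasureTheory.MemLp (fun ζ => plane i (complexKernel α ζ w)) 2 (areaMeasure α) := by
  have := isFiniteMeasure_areaMeasure hα
  have hac : (areaMeasure α).AbsolutelyContinuous
      (MeasureTheory.volume.restrict (Metric.ball (0 : ℂ) 1)) :=
    MeasureTheory.withDensity_absolutelyContinuous _ _
  refine MeasureTheory.MemLp.of_bound ?_ (1 / (1 - ‖w‖) ^ (2 + α)) ?_
  · refine MeasureTheory.AEStronglyMeasurable.mono_ac hac ?_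
    refine ContinuousOn.aestronglyMeasurable (fun ζ hζ => ?_) measurableSet_ball
    obtain ⟨p, hp⟩ := kernel_isHolomorphic i α hw ζ (mem_ball_zero_iff.1 hζ)
    exact hp.continuousAt.continuousWithinAt
  · refine hac.ae_le ?_
    filter_upwards [MeasureTheory.ae_restrict_mem measurableSet_ball] with z hz
    rw [mem_ball_zero_iff] at hz
    have h1 : 1 - ‖w‖ ≤ ‖1 - z * (starRingEnd ℂ) w‖ := by
      have h := norm_sub_norm_le (1 : ℂ) (z * (starRingEnd ℂ) w)
      rw [norm_one, norm_mul, Complex.norm_conj] at h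
      nlinarith [norm_nonneg z, norm_nonneg w]
    rw [norm_plane, complexKernel, norm_div, norm_one, Complex.norm_cpow_real]
    have h0 : 0 < 1 - ‖w‖ := by linarith
    gcongr
    linarith

/-- The slice hyperholomorphic `α`-Bergman kernel `K_w = K_α(·, w)` for `w ∈ 𝔻_i`, that is, the
slice extension of `z ↦ 1 / (1 - z conj(w)) ^ (2 + α)`. -/
def kernel {i : ImaginaryUnit} {α : ℝ} (hα : -1 < α) (w : sliceDisc i) : BergmanSpace i α :=
  ofSlice (fun ζ => plane i (complexKernel α ζ (coord i w)))
    (kernel_isHolomorphic i α (norm_coord_lt w)) (kernel_memLp i hα (norm_coord_lt w))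

/-- The normalized kernel `k_w = K_w / ‖K_w‖`. -/
def normalizedKernel {i : ImaginaryUnit} {α : ℝ} (hα : -1 < α) (w : sliceDisc i) :
    BergmanSpace i α :=
  MulOpposite.op (((bergmanNorm (kernel hα w))⁻¹ : ℝ) : ℍ) • kernel hα w

/-- The Berezin transform `z ↦ ⟨k_z, T k_z⟩` of `T` on `𝔻_i`. -/
def berezin {i : ImaginaryUnit} {α : ℝ} (hα : -1 < α)
    (T : BergmanSpace i α →ₗ[ℍᵐᵒᵖ] BergmanSpace i α) (z : sliceDisc i) : ℍ :=
  scalarProduct (normalizedKernel hα z) (T (normalizedKernel hα z))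

/-- The pseudo-hyperbolic metric `|z - w| / |1 - z conj(w)|`. -/
def pseudoHyperbolic (z w : ℍ) : ℝ := ‖z - w‖ / ‖1 - z * star w‖

end SliceBergman

end

/-!
Let `φ_w` be the Möbius involution of the unit disc exchanging `0` and `w`. The change of variables
`z = φ_w ζ` turns `⟨K_w, f⟩` into the mean value of the holomorphic function
`ζ ↦ f (φ_w ζ) / (1 - ζ conj w) ^ (2 + α)` against a rotation invariant probability measure, hence
into its value `f w` at the origin. This is a statement about complex valued functions, and it is
applied to `ζ ↦ coord i (f ζ * q)` for every quaternion `q`.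

It follows that `|⟨k_z, k_w⟩|² = (1 - ρ(z, w)²) ^ (2 + α)`. After `k_w` is multiplied by a unit of
`ℂ_i`, which commutes with `⟨k_w, T k_w⟩` because `T J = J T`, the number `⟨k_z, k_w⟩` is real and
nonnegative, and polarization gives
`|⟨k_z, T k_z⟩ - ⟨k_w, T k_w⟩| ≤ 2 ‖T‖ √(1 - |⟨k_z, k_w⟩|²)`. Bernoulli's inequality then bounds
the square root by `√(2 + α) ρ(z, w)`.

Equality holds in the polarization bound when `T` is the difference of the orthogonal projections
to `k_z ℍ` and `k_w ℍ`, and the constant in Bernoulli's inequality is attained as `ρ(z, w) → 0`.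
-/

noncomputable section

namespace SliceBergman

open MeasureTheory Filter Topology
open scoped ComplexConjugate RightActions

section HermitianForm

variable {V : Type*}

/-- The seminorm of a positive semidefinite Hermitian form. -/
def formNorm (B : V → V → ℍ) (x : V) : ℝ := √(B x x).re

theorem formNorm_nonneg (B : V → V → ℍ) (x : V) : 0 ≤ formNorm B x := Real.sqrt_nonneg _

variable [AddCommGroup V] [Module ℍᵐᵒᵖ V] {B : V → V → ℍ}

/-- A positive semidefinite Hermitian form on a right quaternionic vector space, linear in the
second variable. -/
structure IsHermitianForm (B : V → V → ℍ) : Prop where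
  add_right : ∀ x y z, B x (y + z) = B x y + B x z
  smul_right : ∀ x y (q : ℍ), B x (y <• q) = B x y * q
  star_apply : ∀ x y, star (B x y) = B y x
  re_self_nonneg : ∀ x, 0 ≤ (B x x).re

namespace IsHermitianForm

theorem sub_right (hB : IsHermitianForm B) (x y z : V) : B x (y - z) = B x y - B x z := by
  rw [eq_sub_iff_add_eq, ← hB.add_right, sub_add_cancel]

theorem add_left (hB : IsHermitianForm B) (x y z : V) : B (x + y) z = B x z + B y z := by
  rw [← hB.star_apply, hB.add_right, star_add, hB.star_apply, hB.star_apply]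

theorem sub_left (hB : IsHermitianForm B) (x y z : V) : B (x - y) z = B x z - B y z := by
  rw [← hB.star_apply, hB.sub_right, star_sub, hB.star_apply, hB.star_apply]

theorem smul_left (hB : IsHermitianForm B) (x y : V) (q : ℍ) :
    B (x <• q) y = star q * B x y := by
  rw [← hB.star_apply, hB.smul_right, star_mul, hB.star_apply]

theorem re_self (hB : IsHermitianForm B) (x : V) : (B x x).re = formNorm B x ^ 2 :=
  (Real.sq_sqrt (hB.re_self_nonneg x)).symm

theorem self_eq (hB : IsHermitianForm B) (x : V) : B x x = (formNorm B x ^ 2 : ℝ) := by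
  rw [← hB.re_self]
  exact Quaternion.star_eq_self.1 (hB.star_apply x x)

theorem re_comm (hB : IsHermitianForm B) (x y : V) : (B x y).re = (B y x).re := by
  rw [← hB.star_apply y x, Quaternion.re_star]

theorem norm_comm (hB : IsHermitianForm B) (x y : V) : ‖B x y‖ = ‖B y x‖ := by
  rw [← hB.star_apply y x, norm_star]

theorem formNorm_smul (hB : IsHermitianForm B) (x : V) (q : ℍ) :
    formNorm B (x <• q) = formNorm B x * ‖q‖ := by
  have h : B (x <• q) (x <• q) = ((formNorm B x * ‖q‖) ^ 2 : ℝ) := by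
    rw [hB.smul_left, hB.smul_right, hB.self_eq, ← mul_assoc, ← Quaternion.coe_commutes, mul_assoc,
      Quaternion.star_mul_self, Quaternion.normSq_eq_norm_mul_self, ← Quaternion.coe_mul, mul_pow,
      sq ‖q‖]
  rw [formNorm, h, Quaternion.re_coe,
    Real.sqrt_sq (mul_nonneg (formNorm_nonneg B x) (norm_nonneg q))]

theorem sq_formNorm_add (hB : IsHermitianForm B) (x y : V) :
    formNorm B (x + y) ^ 2 = formNorm B x ^ 2 + 2 * (B x y).re + formNorm B y ^ 2 := by
  simp only [← hB.re_self, hB.add_left, hB.add_right, Quaternion.re_add, hB.re_comm y x]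
  ring

theorem sq_formNorm_sub (hB : IsHermitianForm B) (x y : V) :
    formNorm B (x - y) ^ 2 = formNorm B x ^ 2 - 2 * (B x y).re + formNorm B y ^ 2 := by
  simp only [← hB.re_self, hB.sub_left, hB.sub_right, Quaternion.re_sub, hB.re_comm y x]
  ring

theorem norm_apply_le (hB : IsHermitianForm B) (x y : V) :
    ‖B x y‖ ≤ formNorm B x * formNorm B y := by
  rcases eq_or_ne (B x y) 0 with h | h
  · rw [h, norm_zero]
    exact mul_nonneg (formNorm_nonneg B x) (formNorm_nonneg B y)
  have hre : ∀ t : ℝ, (B (x <• ((t : ℍ) * B x y)) y).re = t * ‖B x y‖ ^ 2 := fun t => by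
    rw [hB.smul_left, star_mul, Quaternion.star_coe, mul_assoc, Quaternion.coe_commutes,
      ← mul_assoc, Quaternion.star_mul_self, Quaternion.normSq_eq_norm_mul_self,
      ← Quaternion.coe_mul, Quaternion.re_coe]
    ring
  have hquad : ∀ t : ℝ, 0 ≤ (formNorm B x ^ 2 * ‖B x y‖ ^ 2) * (t * t) + (2 * ‖B x y‖ ^ 2) * t +
      formNorm B y ^ 2 := fun t => by
    have hsq := hB.sq_formNorm_add (x <• ((t : ℍ) * B x y)) y
    rw [hre, hB.formNorm_smul, norm_mul, Quaternion.norm_coe, mul_pow, mul_pow, Real.norm_eq_abs,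
      sq_abs] at hsq
    linarith [sq_nonneg (formNorm B (x <• ((t : ℍ) * B x y) + y))]
  have hdiscrim := discrim_le_zero hquad
  have hpos : 0 < ‖B x y‖ ^ 2 := by positivity
  have hsq : ‖B x y‖ ^ 2 ≤ (formNorm B x * formNorm B y) ^ 2 := by
    rw [discrim] at hdiscrim
    refine le_of_mul_le_mul_left ?_ hpos
    linarith
  exact le_of_sq_le_sq hsq (mul_nonneg (formNorm_nonneg B x) (formNorm_nonneg B y))

/-- Polarization bounds the difference by `M ‖a - b‖ ‖a + b‖`, and `‖a ± b‖² = 2 (1 ± ⟨a, b⟩)`. -/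
theorem norm_apply_map_sub_le_of_coe {F : Type*} [FunLike F V V] [AddMonoidHomClass F V V]
    (hB : IsHermitianForm B) (T : F) {M : ℝ}
    (hT : ∀ x, formNorm B (T x) ≤ M * formNorm B x) {a b : V} (ha : formNorm B a = 1)
    (hb : formNorm B b = 1) {r : ℝ} (hr : B a b = r) :
    ‖B a (T a) - B b (T b)‖ ≤ 2 * M * √(1 - r ^ 2) := by
  have hpolar : (2 : ℝ) • (B a (T a) - B b (T b)) =
      B (a - b) (T (a + b)) + B (a + b) (T (a - b)) := by
    simp only [map_add, map_sub, hB.add_right, hB.sub_right, hB.add_left, hB.sub_left]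
    module
  have hprod : formNorm B (a - b) * formNorm B (a + b) = 2 * √(1 - r ^ 2) := by
    have hsub := hB.sq_formNorm_sub a b
    have hadd := hB.sq_formNorm_add a b
    rw [ha, hb, hr, Quaternion.re_coe] at hsub hadd
    have hsq : (formNorm B (a - b) * formNorm B (a + b)) ^ 2 = 2 ^ 2 * (1 - r ^ 2) := by
      rw [mul_pow, hsub, hadd]
      ring
    rw [← Real.sqrt_sq (mul_nonneg (formNorm_nonneg B (a - b)) (formNorm_nonneg B (a + b))), hsq,
      Real.sqrt_mul (by positivity), Real.sqrt_sq zero_le_two]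
  have hcs : ∀ x y, ‖B x (T y)‖ ≤ M * (formNorm B x * formNorm B y) := fun x y =>
    calc ‖B x (T y)‖ ≤ formNorm B x * formNorm B (T y) := hB.norm_apply_le _ _
      _ ≤ formNorm B x * (M * formNorm B y) :=
        mul_le_mul_of_nonneg_left (hT y) (formNorm_nonneg B x)
      _ = M * (formNorm B x * formNorm B y) := mul_left_comm _ _ _
  have hnorm : 2 * ‖B a (T a) - B b (T b)‖ ≤ 2 * (2 * M * √(1 - r ^ 2)) :=
    calc 2 * ‖B a (T a) - B b (T b)‖ = ‖B (a - b) (T (a + b)) + B (a + b) (T (a - b))‖ := by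
          rw [← hpolar, norm_smul, Real.norm_ofNat]
      _ ≤ ‖B (a - b) (T (a + b))‖ + ‖B (a + b) (T (a - b))‖ := norm_add_le _ _
      _ ≤ M * (2 * √(1 - r ^ 2)) + M * (2 * √(1 - r ^ 2)) := by
          rw [← hprod]
          refine add_le_add (hcs _ _) ((hcs _ _).trans_eq ?_)
          rw [mul_comm (formNorm B (a + b))]
      _ = 2 * (2 * M * √(1 - r ^ 2)) := by ring
  linarith

theorem norm_apply_map_sub_le (hB : IsHermitianForm B) (T : V →ₗ[ℍᵐᵒᵖ] V) {M : ℝ}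
    (hT : ∀ x, formNorm B (T x) ≤ M * formNorm B x) {a b : V} (ha : formNorm B a = 1)
    (hb : formNorm B b = 1) (hcomm : Commute (B a b) (B b (T b))) :
    ‖B a (T a) - B b (T b)‖ ≤ 2 * M * √(1 - ‖B a b‖ ^ 2) := by
  rcases eq_or_ne (B a b) 0 with h | h
  · rw [h, norm_zero]
    exact hB.norm_apply_map_sub_le_of_coe T hT ha hb (by rw [h, Quaternion.coe_zero])
  have hn : ‖B a b‖ ≠ 0 := norm_ne_zero_iff.2 h
  set c : ℍ := star (B a b) * (‖B a b‖⁻¹ : ℝ) with hc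
  have hnorm_c : ‖c‖ = 1 := by
    rw [hc, norm_mul, norm_star, Quaternion.norm_coe, norm_inv, norm_norm, mul_inv_cancel₀ hn]
  have hstar : Commute (star (B a b)) (B b (T b)) := by
    rw [Quaternion.star_eq_two_re_sub]
    exact (Quaternion.coe_commute _ _).sub_left hcomm
  have hconj : B (b <• c) (T (b <• c)) = B b (T b) := by
    have hcT : Commute c (B b (T b)) := hstar.mul_left (Quaternion.coe_commute _ _)
    rw [map_smul, hB.smul_left, hB.smul_right, ← hcT.eq, ← mul_assoc, Quaternion.star_mul_self,
      Quaternion.normSq_eq_norm_mul_self, hnorm_c, one_mul, Quaternion.coe_one, one_mul]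
  have hreal : B a (b <• c) = (‖B a b‖ : ℝ) := by
    rw [hB.smul_right, hc, ← mul_assoc, Quaternion.self_mul_star,
      Quaternion.normSq_eq_norm_mul_self, ← Quaternion.coe_mul, mul_assoc, mul_inv_cancel₀ hn,
      mul_one]
  rw [← hconj]
  exact hB.norm_apply_map_sub_le_of_coe T hT ha (by rw [hB.formNorm_smul, hb, hnorm_c, one_mul])
    hreal

/-- By Cauchy–Schwarz `‖T x‖⁴ = ⟨x, T² x⟩² ≤ ‖x‖² ‖T² x‖²`, and
`‖T² x‖² = ⟨T x, T³ x⟩ = s ‖T x‖²`. -/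
theorem formNorm_map_le_of_symmetric (hB : IsHermitianForm B) {T : V → V}
    (hsymm : ∀ x y, B (T x) y = B x (T y)) {s : ℝ} (hcube : ∀ x, T (T (T x)) = T x <• (s : ℍ))
    (x : V) : formNorm B (T x) ≤ √s * formNorm B x := by
  rcases (formNorm_nonneg B (T x)).eq_or_lt with h | h
  · rw [← h]
    exact mul_nonneg (Real.sqrt_nonneg _) (formNorm_nonneg B x)
  have hcs : formNorm B (T x) ^ 2 ≤ formNorm B x * formNorm B (T (T x)) := by
    have hsq : B x (T (T x)) = (formNorm B (T x) ^ 2 : ℝ) := by rw [← hsymm, hB.self_eq]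
    have hle := hB.norm_apply_le x (T (T x))
    rwa [hsq, Quaternion.norm_coe, Real.norm_of_nonneg (sq_nonneg _)] at hle
  have hTT : formNorm B (T (T x)) ^ 2 = s * formNorm B (T x) ^ 2 := by
    rw [← hB.re_self, hsymm, hcube, hB.smul_right, hB.self_eq, ← Quaternion.coe_mul,
      Quaternion.re_coe, mul_comm]
  have hsq : formNorm B (T x) ^ 2 ≤ s * formNorm B x ^ 2 := by
    refine le_of_mul_le_mul_left ?_ (pow_pos h 2)
    calc formNorm B (T x) ^ 2 * formNorm B (T x) ^ 2 = (formNorm B (T x) ^ 2) ^ 2 := by ring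
      _ ≤ (formNorm B x * formNorm B (T (T x))) ^ 2 := pow_le_pow_left₀ (sq_nonneg _) hcs 2
      _ = formNorm B (T x) ^ 2 * (s * formNorm B x ^ 2) := by rw [mul_pow, hTT]; ring
  have hle := Real.le_sqrt_of_sq_le hsq
  rwa [Real.sqrt_mul' s (sq_nonneg _), Real.sqrt_sq (formNorm_nonneg B x)] at hle

/-- The operator `x ↦ a ⟨a, x⟩`: the orthogonal projection to `a ℍ` if `a` is a unit vector. -/
def rankOne (hB : IsHermitianForm B) (a : V) : V →ₗ[ℍᵐᵒᵖ] V where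
  toFun x := a <• B a x
  map_add' x y := by rw [hB.add_right, MulOpposite.op_add, add_smul]
  map_smul' c x := by
    rw [RingHom.id_apply, ← MulOpposite.op_unop c, hB.smul_right, MulOpposite.op_mul, mul_smul]

/-- The difference of the orthogonal projections to `a ℍ` and `b ℍ`, for unit vectors `a`, `b`. -/
def projDiff (hB : IsHermitianForm B) (a b : V) : V →ₗ[ℍᵐᵒᵖ] V := hB.rankOne a - hB.rankOne b

theorem projDiff_apply (hB : IsHermitianForm B) (a b x : V) :
    hB.projDiff a b x = a <• B a x - b <• B b x := rfl

theorem projDiff_symmetric (hB : IsHermitianForm B) (a b x y : V) :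
    B (hB.projDiff a b x) y = B x (hB.projDiff a b y) := by
  simp only [projDiff_apply, hB.sub_left, hB.sub_right, hB.smul_left, hB.smul_right, hB.star_apply]

theorem projDiff_apply_left (hB : IsHermitianForm B) {a : V} (b : V) (ha : formNorm B a = 1) :
    hB.projDiff a b a = a - b <• B b a := by
  rw [projDiff_apply, hB.self_eq, ha, one_pow, Quaternion.coe_one, MulOpposite.op_one, one_smul]

theorem projDiff_apply_right (hB : IsHermitianForm B) (a : V) {b : V} (hb : formNorm B b = 1) :
    hB.projDiff a b b = a <• B a b - b := by
  rw [projDiff_apply, hB.self_eq, hb, one_pow, Quaternion.coe_one, MulOpposite.op_one, one_smul]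

theorem apply_mul_apply_swap (hB : IsHermitianForm B) (x y : V) :
    B x y * B y x = (‖B x y‖ ^ 2 : ℝ) := by
  rw [← hB.star_apply x y, Quaternion.self_mul_star, Quaternion.normSq_eq_norm_mul_self, sq]

theorem projDiff_projDiff_left (hB : IsHermitianForm B) {a b : V} (ha : formNorm B a = 1)
    (hb : formNorm B b = 1) :
    hB.projDiff a b (hB.projDiff a b a) = a <• ((1 - ‖B a b‖ ^ 2 : ℝ) : ℍ) := by
  rw [hB.projDiff_apply_left b ha, map_sub, map_smul, hB.projDiff_apply_left b ha,
    hB.projDiff_apply_right a hb, smul_sub, ← mul_smul, ← MulOpposite.op_mul,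
    hB.apply_mul_apply_swap, Quaternion.coe_sub, Quaternion.coe_one, MulOpposite.op_sub, sub_smul,
    MulOpposite.op_one, one_smul]
  abel

theorem projDiff_projDiff_right (hB : IsHermitianForm B) {a b : V} (ha : formNorm B a = 1)
    (hb : formNorm B b = 1) :
    hB.projDiff a b (hB.projDiff a b b) = b <• ((1 - ‖B a b‖ ^ 2 : ℝ) : ℍ) := by
  rw [hB.projDiff_apply_right a hb, map_sub, map_smul, hB.projDiff_apply_left b ha,
    hB.projDiff_apply_right a hb, smul_sub, ← mul_smul, ← MulOpposite.op_mul,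
    hB.apply_mul_apply_swap, hB.norm_comm b a, Quaternion.coe_sub, Quaternion.coe_one,
    MulOpposite.op_sub, sub_smul, MulOpposite.op_one, one_smul]
  abel

theorem projDiff_cube (hB : IsHermitianForm B) {a b : V} (ha : formNorm B a = 1)
    (hb : formNorm B b = 1) (x : V) :
    hB.projDiff a b (hB.projDiff a b (hB.projDiff a b x)) =
      hB.projDiff a b x <• ((1 - ‖B a b‖ ^ 2 : ℝ) : ℍ) := by
  rw [hB.projDiff_apply a b x]
  simp only [map_sub, map_smul, hB.projDiff_projDiff_left ha hb, hB.projDiff_projDiff_right ha hb,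
    smul_sub, ← mul_smul, ← MulOpposite.op_mul, Quaternion.coe_commutes]

theorem formNorm_projDiff_le (hB : IsHermitianForm B) {a b : V} (ha : formNorm B a = 1)
    (hb : formNorm B b = 1) (x : V) :
    formNorm B (hB.projDiff a b x) ≤ √(1 - ‖B a b‖ ^ 2) * formNorm B x :=
  hB.formNorm_map_le_of_symmetric (hB.projDiff_symmetric a b) (hB.projDiff_cube ha hb) x

theorem formNorm_projDiff_left (hB : IsHermitianForm B) {a b : V} (ha : formNorm B a = 1)
    (hb : formNorm B b = 1) : formNorm B (hB.projDiff a b a) = √(1 - ‖B a b‖ ^ 2) := by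
  rw [formNorm, hB.projDiff_symmetric, hB.projDiff_projDiff_left ha hb, hB.smul_right, hB.self_eq,
    ha, one_pow, Quaternion.coe_one, one_mul, Quaternion.re_coe]

theorem apply_projDiff_sub_apply_projDiff (hB : IsHermitianForm B) {a b : V}
    (ha : formNorm B a = 1) (hb : formNorm B b = 1) :
    B a (hB.projDiff a b a) - B b (hB.projDiff a b b) =
      ((2 * (1 - ‖B a b‖ ^ 2) : ℝ) : ℍ) := by
  rw [hB.projDiff_apply_left b ha, hB.projDiff_apply_right a hb, hB.sub_right, hB.sub_right,
    hB.smul_right, hB.smul_right, hB.apply_mul_apply_swap, hB.apply_mul_apply_swap,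
    hB.norm_comm b a, hB.self_eq, hB.self_eq, ha, hb, ← Quaternion.coe_sub, ← Quaternion.coe_sub,
    ← Quaternion.coe_sub]
  congr 1
  ring

end IsHermitianForm

end HermitianForm

section AreaMeasure

variable {E : Type*} [NormedAddCommGroup E] {α : ℝ}

/-- The density of `areaMeasure α` with respect to Lebesgue measure on the unit disc. -/
def areaDensity (α : ℝ) (z : ℂ) : ℝ := (α + 1) / Real.pi * (1 - ‖z‖ ^ 2) ^ α

theorem one_sub_norm_sq_pos {z : ℂ} (hz : ‖z‖ < 1) : 0 < 1 - ‖z‖ ^ 2 :=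
  sub_pos.2 (pow_lt_one₀ (norm_nonneg z) hz two_ne_zero)

theorem areaDensity_nonneg (hα : -1 < α) {z : ℂ} (hz : z ∈ Metric.ball (0 : ℂ) 1) :
    0 ≤ areaDensity α z :=
  mul_nonneg (div_nonneg (by linarith) Real.pi_pos.le)
    (Real.rpow_nonneg (one_sub_norm_sq_pos (mem_ball_zero_iff.1 hz)).le α)

theorem measurable_areaDensity (α : ℝ) : Measurable (areaDensity α) := by
  unfold areaDensity
  fun_prop

theorem areaMeasure_eq (α : ℝ) : areaMeasure α =
    (volume.restrict (Metric.ball (0 : ℂ) 1)).withDensity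
      fun z => ENNReal.ofReal (areaDensity α z) := rfl

theorem ae_areaMeasure_norm_lt (α : ℝ) : ∀ᵐ z ∂(areaMeasure α), ‖z‖ < 1 := by
  refine (withDensity_absolutelyContinuous _ _).ae_le ?_
  filter_upwards [ae_restrict_mem measurableSet_ball] with z hz
  exact mem_ball_zero_iff.1 hz

theorem integral_areaMeasure [NormedSpace ℝ E] (hα : -1 < α) (g : ℂ → E) :
    ∫ z, g z ∂(areaMeasure α) = ∫ z in Metric.ball (0 : ℂ) 1, areaDensity α z • g z := by
  rw [areaMeasure_eq, integral_withDensity_eq_integral_toReal_smul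
    (measurable_areaDensity α).ennreal_ofReal (by simp)]
  refine setIntegral_congr_fun measurableSet_ball fun z hz => ?_
  rw [ENNReal.toReal_ofReal (areaDensity_nonneg hα hz)]

theorem integrable_areaMeasure_iff [NormedSpace ℝ E] (hα : -1 < α) (g : ℂ → E) :
    Integrable g (areaMeasure α) ↔
      IntegrableOn (fun z => areaDensity α z • g z) (Metric.ball (0 : ℂ) 1) := by
  rw [areaMeasure_eq, integrable_withDensity_iff_integrable_smul'
    (measurable_areaDensity α).ennreal_ofReal (by simp)]
  refine integrableOn_congr_fun (fun z hz => ?_) measurableSet_ball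
  rw [ENNReal.toReal_ofReal (areaDensity_nonneg hα hz)]

theorem setIntegral_ball_fun_norm [NormedSpace ℝ E] {R : ℝ} (hR : 0 ≤ R) (f : ℝ → E) :
    ∫ z in Metric.ball (0 : ℂ) R, f ‖z‖ = (2 * Real.pi) • ∫ y in (0 : ℝ)..R, y • f y := by
  have hball : (Metric.ball (0 : ℂ) R).indicator (fun z => f ‖z‖) =
      fun z => (Set.Iio R).indicator f ‖z‖ := by
    funext z
    by_cases h : ‖z‖ < R <;> simp [Set.indicator, h]
  have hsmul : (fun y : ℝ => y • (Set.Iio R).indicator f y) =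
      (Set.Iio R).indicator fun y => y • f y := by
    funext y
    by_cases h : y ∈ Set.Iio R <;> simp [h]
  rw [← integral_indicator measurableSet_ball, hball, integral_fun_norm_addHaar,
    Complex.finrank_real_complex]
  simp only [Nat.add_one_sub_one, pow_one]
  rw [hsmul, setIntegral_indicator measurableSet_Iio, Set.Ioi_inter_Iio,
    ← integral_Ioc_eq_integral_Ioo, ← intervalIntegral.integral_of_le hR, Measure.real,
    Complex.volume_ball, ← Nat.cast_smul_eq_nsmul ℝ, smul_smul]
  simp

theorem integral_mul_one_sub_sq_rpow (hα : -1 < α) :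
    ∫ y in (0 : ℝ)..1, y * (1 - y ^ 2) ^ α = 1 / (2 * (α + 1)) := by
  have hα' : α + 1 ≠ 0 := by linarith
  have hpos : ∀ y ∈ Set.Ioo (0 : ℝ) 1, 0 < 1 - y ^ 2 := fun y hy => by nlinarith [hy.1, hy.2]
  have hderiv : ∀ y ∈ Set.Ioo (0 : ℝ) 1,
      HasDerivAt (fun y : ℝ => -(1 - y ^ 2) ^ (α + 1) / (2 * (α + 1)))
        (y * (1 - y ^ 2) ^ α) y := by
    intro y hy
    refine (((((hasDerivAt_id y).pow 2).const_sub 1).rpow_const (p := α + 1)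
      (Or.inl (hpos y hy).ne')).neg.div_const (2 * (α + 1))).congr_deriv ?_
    simp only [id_eq, add_sub_cancel_right]
    field_simp
    norm_num
  have hcont : ContinuousOn (fun y : ℝ => -(1 - y ^ 2) ^ (α + 1) / (2 * (α + 1)))
      (Set.Icc 0 1) :=
    (ContinuousOn.rpow_const (by fun_prop) fun y _ => Or.inr (by linarith)).neg.div_const _
  rw [intervalIntegral.integral_eq_sub_of_hasDerivAt_of_le zero_le_one hcont hderiv]
  · simp only [one_pow, sub_self, Real.zero_rpow hα', neg_zero, zero_div, ne_eq,
      OfNat.ofNat_ne_zero, not_false_eq_true, zero_pow, sub_zero, Real.one_rpow, zero_sub, neg_div,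
      neg_neg]
  · rw [intervalIntegrable_iff_integrableOn_Ioc_of_le zero_le_one]
    exact intervalIntegral.integrableOn_deriv_of_nonneg hcont hderiv fun y hy =>
      mul_nonneg hy.1.le (Real.rpow_nonneg (hpos y hy).le _)

theorem isProbabilityMeasure_areaMeasure (hα : -1 < α) : IsProbabilityMeasure (areaMeasure α) := by
  have hα' : α + 1 ≠ 0 := by linarith
  rw [isProbabilityMeasure_iff_real, ← setIntegral_one_eq_measureReal, Measure.restrict_univ,
    integral_areaMeasure hα]
  simp only [areaDensity, smul_eq_mul, mul_one]
  rw [integral_const_mul, setIntegral_ball_fun_norm zero_le_one fun y => (1 - y ^ 2) ^ α]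
  simp only [smul_eq_mul]
  rw [integral_mul_one_sub_sq_rpow hα]
  field_simp

theorem measurePreserving_mul_areaMeasure (α : ℝ) (c : Circle) :
    MeasurePreserving (fun z : ℂ => (c : ℂ) * z) (areaMeasure α) (areaMeasure α) := by
  have hrot : MeasurePreserving (fun z : ℂ => (c : ℂ) * z) volume volume :=
    (rotation c).measurePreserving
  have hball : (fun z : ℂ => (c : ℂ) * z) ⁻¹' Metric.ball 0 1 = Metric.ball 0 1 := by
    ext z
    simp [Circle.norm_coe]
  have hrestrict := hrot.restrict_preimage (measurableSet_ball (x := (0 : ℂ)) (ε := 1))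
  rw [hball] at hrestrict
  refine ⟨hrot.measurable, Measure.ext fun s hs => ?_⟩
  rw [Measure.map_apply hrot.measurable hs, areaMeasure_eq, withDensity_apply _ hs,
    withDensity_apply _ (hrot.measurable hs), ← hrestrict.setLIntegral_comp_preimage hs
      (measurable_areaDensity α).ennreal_ofReal]
  simp only [areaDensity, norm_mul, Circle.norm_coe, one_mul]

end AreaMeasure

section MeanValue

variable {E : Type*} [NormedAddCommGroup E] [NormedSpace ℂ E] [CompleteSpace E] {h : ℂ → E} {R : ℝ}

theorem circleAverage_comp_mul_right (hd : DifferentiableOn ℂ h (Metric.ball 0 R)) {z : ℂ}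
    (hz : ‖z‖ < R) : Real.circleAverage (fun ζ => h (ζ * z)) 0 1 = h 0 := by
  have hmaps : Set.MapsTo (fun ζ => ζ * z) (Metric.closedBall 0 1) (Metric.ball 0 R) := by
    intro ζ hζ
    rw [mem_closedBall_zero_iff] at hζ
    rw [mem_ball_zero_iff, norm_mul]
    exact (mul_le_of_le_one_left (norm_nonneg z) hζ).trans_lt hz
  have hcomp : DifferentiableOn ℂ (fun ζ => h (ζ * z)) (Metric.closedBall 0 1) :=
    hd.comp (by fun_prop) hmaps
  have hmean : Real.circleAverage (fun ζ => h (ζ * z)) 0 1 = h (0 * z) := by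
    refine DiffContOnCl.circleAverage (DifferentiableOn.diffContOnCl ?_)
    rwa [abs_one, closure_ball _ one_ne_zero]
  rwa [zero_mul] at hmean

theorem integral_eq_apply_zero_of_rotation_invariant {μ : Measure ℂ} [IsProbabilityMeasure μ]
    (hrot : ∀ c : Circle, MeasurePreserving (fun z : ℂ => (c : ℂ) * z) μ μ)
    (hR : ∀ᵐ z ∂μ, ‖z‖ < R) (hd : DifferentiableOn ℂ h (Metric.ball 0 R)) (hi : Integrable h μ) :
    ∫ z, h z ∂μ = h 0 := by
  have hpi : 0 ≤ 2 * Real.pi := Real.two_pi_pos.le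
  set ν : Measure ℝ := volume.restrict (Set.Ioc 0 (2 * Real.pi)) with hν
  have hskew : MeasurePreserving (fun x : ℝ × ℂ => (x.1, (Circle.exp x.1 : ℂ) * x.2))
      (ν.prod μ) (ν.prod μ) := by
    refine (MeasurePreserving.id ν).skew_product (g := fun θ z => (Circle.exp θ : ℂ) * z) ?_
      (Eventually.of_forall fun θ => (hrot (Circle.exp θ)).map_eq)
    exact Continuous.measurable (by unfold Function.uncurry; fun_prop)
  have hint : Integrable (Function.uncurry fun (z : ℂ) (θ : ℝ) => h (Circle.exp θ * z))
      (μ.prod ν) :=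
    (hskew.integrable_comp_of_integrable (hi.comp_snd ν)).swap
  have hinner : ∀ θ : ℝ, ∫ z, h (Circle.exp θ * z) ∂μ = ∫ z, h z ∂μ := fun θ =>
    (hrot (Circle.exp θ)).integral_comp
      (Homeomorph.mulLeft₀ (Circle.exp θ : ℂ) (Circle.coe_ne_zero _)).measurableEmbedding h
  have hcircle : ∀ z : ℂ, Real.circleAverage (fun ζ => h (ζ * z)) 0 1 =
      (2 * Real.pi)⁻¹ • ∫ θ, h (Circle.exp θ * z) ∂ν := fun z => by
    rw [Real.circleAverage_def, intervalIntegral.integral_of_le hpi]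
    simp [circleMap, hν]
  calc ∫ z, h z ∂μ = (2 * Real.pi)⁻¹ • ∫ _, ∫ z, h z ∂μ ∂ν := by
        rw [integral_const, hν, measureReal_restrict_apply_univ, Real.volume_real_Ioc_of_le hpi,
          sub_zero, inv_smul_smul₀ Real.two_pi_pos.ne']
    _ = (2 * Real.pi)⁻¹ • ∫ z, ∫ θ, h (Circle.exp θ * z) ∂ν ∂μ := by
        rw [integral_integral_swap hint]
        simp only [hinner]
    _ = ∫ _, h 0 ∂μ := by
        rw [← integral_smul]
        refine integral_congr_ae (hR.mono fun z hz => ?_)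
        simp only [← hcircle, circleAverage_comp_mul_right hd hz]
    _ = h 0 := by rw [integral_const, probReal_univ, one_smul]

end MeanValue

section Mobius

variable {α : ℝ} {z w : ℂ}

/-- The involutive automorphism of the unit disc that exchanges `0` and `w`. -/
def mobius (w ζ : ℂ) : ℂ := (w - ζ) / (1 - ζ * conj w)

theorem mobius_zero (w : ℂ) : mobius w 0 = w := by simp [mobius]

theorem one_sub_mul_conj_ne_zero (hz : ‖z‖ < 1) (hw : ‖w‖ < 1) : 1 - z * conj w ≠ 0 := fun h =>
  (kernel_base hz hw).ne' (by rw [h, Complex.zero_re])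

theorem one_sub_norm_sq_ne_zero (hw : ‖w‖ < 1) : ((1 - ‖w‖ ^ 2 : ℝ) : ℂ) ≠ 0 :=
  Complex.ofReal_ne_zero.2 (one_sub_norm_sq_pos hw).ne'

theorem ofReal_one_sub_norm_sq (w : ℂ) : ((1 - ‖w‖ ^ 2 : ℝ) : ℂ) = 1 - w * conj w := by
  rw [Complex.mul_conj', Complex.ofReal_sub, Complex.ofReal_one, Complex.ofReal_pow]

theorem one_sub_mobius_mul_conj (hz : ‖z‖ < 1) (hw : ‖w‖ < 1) :
    1 - mobius w z * conj w = ((1 - ‖w‖ ^ 2 : ℝ) : ℂ) / (1 - z * conj w) := by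
  have := one_sub_mul_conj_ne_zero hz hw
  rw [ofReal_one_sub_norm_sq, mobius]
  field_simp
  ring

theorem one_sub_norm_mobius_sq (hz : ‖z‖ < 1) (hw : ‖w‖ < 1) :
    1 - ‖mobius w z‖ ^ 2 = (1 - ‖w‖ ^ 2) * (1 - ‖z‖ ^ 2) / ‖1 - z * conj w‖ ^ 2 := by
  have hne := norm_ne_zero_iff.2 (one_sub_mul_conj_ne_zero hz hw)
  have hsq : ‖1 - z * conj w‖ ^ 2 - ‖w - z‖ ^ 2 = (1 - ‖w‖ ^ 2) * (1 - ‖z‖ ^ 2) := by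
    simp only [Complex.sq_norm, Complex.normSq_apply, Complex.sub_re, Complex.sub_im,
      Complex.mul_re, Complex.mul_im, Complex.conj_re, Complex.conj_im, Complex.one_re,
      Complex.one_im]
    ring
  rw [← hsq, mobius, norm_div]
  field_simp

theorem norm_mobius_lt_one (hz : ‖z‖ < 1) (hw : ‖w‖ < 1) : ‖mobius w z‖ < 1 := by
  have hne := norm_pos_iff.2 (one_sub_mul_conj_ne_zero hz hw)
  have hpos : 0 < 1 - ‖mobius w z‖ ^ 2 := by
    rw [one_sub_norm_mobius_sq hz hw]
    exact div_pos (mul_pos (one_sub_norm_sq_pos hw) (one_sub_norm_sq_pos hz)) (pow_pos hne 2)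
  exact (sq_lt_one_iff₀ (norm_nonneg _)).1 (sub_pos.1 hpos)

theorem mobius_mobius (hz : ‖z‖ < 1) (hw : ‖w‖ < 1) : mobius w (mobius w z) = z := by
  have hz' := one_sub_mul_conj_ne_zero hz hw
  rw [mobius, one_sub_mobius_mul_conj hz hw, div_eq_iff (div_ne_zero (one_sub_norm_sq_ne_zero hw)
    hz'), ofReal_one_sub_norm_sq, mobius]
  field_simp
  ring

theorem bijOn_mobius (hw : ‖w‖ < 1) :
    Set.BijOn (mobius w) (Metric.ball 0 1) (Metric.ball 0 1) := by
  have hmaps : Set.MapsTo (mobius w) (Metric.ball 0 1) (Metric.ball 0 1) := fun z hz =>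
    mem_ball_zero_iff.2 (norm_mobius_lt_one (mem_ball_zero_iff.1 hz) hw)
  have hinv : Set.LeftInvOn (mobius w) (mobius w) (Metric.ball 0 1) := fun z hz =>
    mobius_mobius (mem_ball_zero_iff.1 hz) hw
  exact Set.InvOn.bijOn ⟨hinv, hinv⟩ hmaps hmaps

/-- The derivative of `mobius w` at `z`. -/
def mobiusDeriv (w z : ℂ) : ℂ := -((1 - ‖w‖ ^ 2 : ℝ) : ℂ) / (1 - z * conj w) ^ 2

theorem hasDerivAt_mobius (hz : ‖z‖ < 1) (hw : ‖w‖ < 1) :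
    HasDerivAt (mobius w) (mobiusDeriv w z) z := by
  refine (((hasDerivAt_id z).const_sub w).div
    (((hasDerivAt_id z).mul_const (conj w)).const_sub 1)
      (one_sub_mul_conj_ne_zero hz hw)).congr_deriv ?_
  rw [mobiusDeriv, ofReal_one_sub_norm_sq]
  simp only [id]
  congr 1
  ring

theorem differentiableOn_mobius (hw : ‖w‖ < 1) :
    DifferentiableOn ℂ (mobius w) (Metric.ball 0 1) := fun _ hz =>
  (hasDerivAt_mobius (mem_ball_zero_iff.1 hz) hw).differentiableAt.differentiableWithinAt

theorem norm_mobiusDeriv (hw : ‖w‖ < 1) (z : ℂ) :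
    ‖mobiusDeriv w z‖ = (1 - ‖w‖ ^ 2) / ‖1 - z * conj w‖ ^ 2 := by
  rw [mobiusDeriv, norm_div, norm_neg, norm_pow, Complex.norm_real,
    Real.norm_of_nonneg (one_sub_norm_sq_pos hw).le]

theorem det_restrictScalars_toSpanSingleton (a : ℂ) :
    ((ContinuousLinearMap.toSpanSingleton ℂ a).restrictScalars ℝ).det = ‖a‖ ^ 2 := by
  have hmul : (((ContinuousLinearMap.toSpanSingleton ℂ a).restrictScalars ℝ : ℂ →L[ℝ] ℂ) :
      ℂ →ₗ[ℝ] ℂ) = LinearMap.mul ℝ ℂ a := by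
    ext; simp [mul_comm]
  rw [ContinuousLinearMap.det, hmul, Complex.sq_norm, ← Algebra.norm_complex_apply]
  rfl

/-- `1 - |φ|² = |φ'| (1 - |z|²)` for `φ = mobius w`, whose Jacobian determinant is `|φ'|²`. -/
theorem sq_norm_mobiusDeriv_mul_areaDensity (hz : ‖z‖ < 1) (hw : ‖w‖ < 1) :
    ‖mobiusDeriv w z‖ ^ 2 * areaDensity α (mobius w z) =
      areaDensity α z * ‖mobiusDeriv w z‖ ^ (2 + α) := by
  have hbase := norm_pos_iff.2 (one_sub_mul_conj_ne_zero hz hw)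
  have hpos : 0 < ‖mobiusDeriv w z‖ := by
    rw [norm_mobiusDeriv hw]
    exact div_pos (one_sub_norm_sq_pos hw) (pow_pos hbase 2)
  have hnorm : 1 - ‖mobius w z‖ ^ 2 = ‖mobiusDeriv w z‖ * (1 - ‖z‖ ^ 2) := by
    rw [one_sub_norm_mobius_sq hz hw, norm_mobiusDeriv hw, div_mul_eq_mul_div]
  rw [areaDensity, areaDensity, hnorm, Real.mul_rpow hpos.le (one_sub_norm_sq_pos hz).le,
    Real.rpow_add hpos, Real.rpow_two]
  ring

section ChangeOfVariables

variable {E : Type*} [NormedAddCommGroup E] [NormedSpace ℝ E]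

theorem abs_det_mobiusDeriv_smul_areaDensity_smul (g : ℂ → E) (hw : ‖w‖ < 1)
    (hz : z ∈ Metric.ball (0 : ℂ) 1) :
    |((ContinuousLinearMap.toSpanSingleton ℂ (mobiusDeriv w z)).restrictScalars ℝ).det| •
        areaDensity α (mobius w z) • g (mobius w z) =
      areaDensity α z • ‖mobiusDeriv w z‖ ^ (2 + α) • g (mobius w z) := by
  rw [det_restrictScalars_toSpanSingleton, abs_of_nonneg (sq_nonneg _), smul_smul, smul_smul,
    sq_norm_mobiusDeriv_mul_areaDensity (mem_ball_zero_iff.1 hz) hw]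

theorem hasFDerivWithinAt_mobius (hw : ‖w‖ < 1) (z : ℂ) (hz : z ∈ Metric.ball (0 : ℂ) 1) :
    HasFDerivWithinAt (mobius w)
      ((ContinuousLinearMap.toSpanSingleton ℂ (mobiusDeriv w z)).restrictScalars ℝ)
      (Metric.ball 0 1) z :=
  ((hasDerivAt_mobius (mem_ball_zero_iff.1 hz) hw).hasFDerivAt.restrictScalars
    ℝ).hasFDerivWithinAt

theorem integral_areaMeasure_comp_mobius (hα : -1 < α) (hw : ‖w‖ < 1) (g : ℂ → E) :
    ∫ z, ‖mobiusDeriv w z‖ ^ (2 + α) • g (mobius w z) ∂(areaMeasure α) =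
      ∫ z, g z ∂(areaMeasure α) := by
  rw [integral_areaMeasure hα, integral_areaMeasure hα]
  conv_rhs => rw [← (bijOn_mobius hw).image_eq]
  rw [integral_image_eq_integral_abs_det_fderiv_smul _ measurableSet_ball
    (hasFDerivWithinAt_mobius hw) (bijOn_mobius hw).injOn]
  exact setIntegral_congr_fun measurableSet_ball fun z hz =>
    (abs_det_mobiusDeriv_smul_areaDensity_smul g hw hz).symm

theorem integrable_areaMeasure_comp_mobius (hα : -1 < α) (hw : ‖w‖ < 1) {g : ℂ → E}
    (hg : Integrable g (areaMeasure α)) :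
    Integrable (fun z => ‖mobiusDeriv w z‖ ^ (2 + α) • g (mobius w z)) (areaMeasure α) := by
  rw [integrable_areaMeasure_iff hα] at hg ⊢
  rw [← (bijOn_mobius hw).image_eq, integrableOn_image_iff_integrableOn_abs_det_fderiv_smul _
    measurableSet_ball (hasFDerivWithinAt_mobius hw) (bijOn_mobius hw).injOn] at hg
  exact hg.congr_fun (fun z hz => abs_det_mobiusDeriv_smul_areaDensity_smul g hw hz)
    measurableSet_ball

end ChangeOfVariables

theorem one_sub_mul_conj_cpow_ne_zero (hz : ‖z‖ < 1) (hw : ‖w‖ < 1) (s : ℂ) :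
    (1 - z * conj w) ^ s ≠ 0 := by
  rw [Ne, Complex.cpow_eq_zero_iff]
  exact fun h => one_sub_mul_conj_ne_zero hz hw h.1

theorem complexKernel_zero_left (α : ℝ) (w : ℂ) : complexKernel α 0 w = 1 := by
  simp [complexKernel]

theorem complexKernel_self (α : ℝ) (hw : ‖w‖ < 1) :
    complexKernel α w w = (((1 - ‖w‖ ^ 2) ^ (2 + α))⁻¹ : ℝ) := by
  rw [complexKernel, ← ofReal_one_sub_norm_sq, ← Complex.ofReal_cpow (one_sub_norm_sq_pos hw).le,
    one_div, Complex.ofReal_inv]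

theorem norm_complexKernel (α : ℝ) (z w : ℂ) :
    ‖complexKernel α z w‖ = (‖1 - z * conj w‖ ^ (2 + α))⁻¹ := by
  rw [complexKernel, norm_div, norm_one, Complex.norm_cpow_real, one_div]

theorem differentiableOn_complexKernel (α : ℝ) (hw : ‖w‖ < 1) :
    DifferentiableOn ℂ (fun z => complexKernel α z w) (Metric.ball 0 1) := by
  intro ζ hζ
  have hζ' := mem_ball_zero_iff.1 hζ
  have hbase : DifferentiableAt ℂ (fun z : ℂ => 1 - z * conj w) ζ := by fun_prop
  exact ((differentiableAt_const _).div (hbase.cpow_const (Or.inl (kernel_base hζ' hw)))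
    (one_sub_mul_conj_cpow_ne_zero hζ' hw _)).differentiableWithinAt

theorem ofReal_div_cpow {s : ℝ} (hs : 0 < s) (hz : 0 < z.re) (p : ℂ) :
    ((s : ℂ) / z) ^ p = (s : ℂ) ^ p / z ^ p := by
  have hz0 : z ≠ 0 := fun h => hz.ne' (by rw [h, Complex.zero_re])
  have hs0 : (s : ℂ) ≠ 0 := Complex.ofReal_ne_zero.2 hs.ne'
  have harg : z.arg ≠ Real.pi := fun h => (Complex.arg_eq_pi_iff.1 h).1.not_gt hz
  rw [div_eq_mul_inv, Complex.cpow_def_of_ne_zero (mul_ne_zero hs0 (inv_ne_zero hz0)),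
    Complex.log_ofReal_mul hs (inv_ne_zero hz0), Complex.ofReal_log hs.le, add_mul,
    Complex.exp_add, ← Complex.cpow_def_of_ne_zero hs0,
    ← Complex.cpow_def_of_ne_zero (inv_ne_zero hz0), Complex.inv_cpow _ _ harg, ← div_eq_mul_inv]

theorem norm_mobiusDeriv_rpow (hz : ‖z‖ < 1) (hw : ‖w‖ < 1) (p : ℝ) :
    ((‖mobiusDeriv w z‖ ^ p : ℝ) : ℂ) =
      ((1 - ‖w‖ ^ 2 : ℝ) : ℂ) ^ (p : ℂ) /
        ((1 - z * conj w) ^ (p : ℂ) * conj ((1 - z * conj w) ^ (p : ℂ))) := by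
  have hpos := one_sub_norm_sq_pos hw
  have hbase := norm_pos_iff.2 (one_sub_mul_conj_ne_zero hz hw)
  have hsq : (‖1 - z * conj w‖ ^ 2) ^ p = ‖(1 - z * conj w) ^ (p : ℂ)‖ ^ 2 := by
    rw [Complex.norm_cpow_real, Real.rpow_pow_comm hbase.le]
  rw [norm_mobiusDeriv hw, Real.div_rpow hpos.le (sq_nonneg _), hsq, Complex.mul_conj',
    Complex.ofReal_div, Complex.ofReal_cpow hpos.le, Complex.ofReal_pow]

theorem norm_mobiusDeriv_rpow_mul_conj_complexKernel (α : ℝ) (hz : ‖z‖ < 1) (hw : ‖w‖ < 1) :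
    ((‖mobiusDeriv w z‖ ^ (2 + α) : ℝ) : ℂ) * conj (complexKernel α (mobius w z) w) =
      complexKernel α z w := by
  have hpos := one_sub_norm_sq_pos hw
  have hbase := one_sub_mul_conj_cpow_ne_zero hz hw ((2 + α : ℝ) : ℂ)
  have hbase' := (map_ne_zero (starRingEnd ℂ)).2 hbase
  have hs : ((1 - ‖w‖ ^ 2 : ℝ) : ℂ) ^ ((2 + α : ℝ) : ℂ) ≠ 0 := by
    rw [Ne, Complex.cpow_eq_zero_iff]
    exact fun h => one_sub_norm_sq_ne_zero hw h.1
  have hconj : conj (((1 - ‖w‖ ^ 2 : ℝ) : ℂ) ^ ((2 + α : ℝ) : ℂ)) =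
      ((1 - ‖w‖ ^ 2 : ℝ) : ℂ) ^ ((2 + α : ℝ) : ℂ) := by
    rw [← Complex.ofReal_cpow hpos.le, Complex.conj_ofReal]
  rw [complexKernel, complexKernel, one_sub_mobius_mul_conj hz hw,
    ofReal_div_cpow hpos (kernel_base hz hw), norm_mobiusDeriv_rpow hz hw, one_div_div, map_div₀,
    hconj]
  field_simp

theorem integral_conj_complexKernel_smul {E : Type*} [NormedAddCommGroup E] [NormedSpace ℂ E]
    [CompleteSpace E] (hα : -1 < α) (hw : ‖w‖ < 1) {φ : ℂ → E}
    (hd : DifferentiableOn ℂ φ (Metric.ball 0 1))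
    (hi : Integrable (fun z => conj (complexKernel α z w) • φ z) (areaMeasure α)) :
    ∫ z, conj (complexKernel α z w) • φ z ∂(areaMeasure α) = φ w := by
  have := isProbabilityMeasure_areaMeasure hα
  have hweight : (fun z => ‖mobiusDeriv w z‖ ^ (2 + α) •
      conj (complexKernel α (mobius w z) w) • φ (mobius w z)) =ᵐ[areaMeasure α]
      fun z => complexKernel α z w • φ (mobius w z) := by
    filter_upwards [ae_areaMeasure_norm_lt α] with z hz
    rw [← Complex.coe_smul, smul_smul, norm_mobiusDeriv_rpow_mul_conj_complexKernel α hz hw]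
  rw [← integral_areaMeasure_comp_mobius hα hw, integral_congr_ae hweight,
    integral_eq_apply_zero_of_rotation_invariant (measurePreserving_mul_areaMeasure α)
      (ae_areaMeasure_norm_lt α) _ ((integrable_areaMeasure_comp_mobius hα hw hi).congr hweight),
    complexKernel_zero_left, mobius_zero, one_smul]
  exact (differentiableOn_complexKernel α hw).smul
    (hd.comp (differentiableOn_mobius hw) (bijOn_mobius hw).mapsTo)

end Mobius

section Slice

variable {i : ImaginaryUnit}

theorem plane_ofReal (i : ImaginaryUnit) (r : ℝ) : plane i r = (r : ℍ) := by simp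

theorem plane_I (i : ImaginaryUnit) : plane i Complex.I = i := by simp [plane_apply]

theorem commute_imaginaryUnit_plane (i : ImaginaryUnit) (ζ : ℂ) : Commute (i : ℍ) (plane i ζ) := by
  rw [← plane_I]
  exact (Commute.all _ _).map (plane i)

theorem commute_plane_of_commute {x : ℍ} (hx : Commute (i : ℍ) x) (ζ : ℂ) :
    Commute (plane i ζ) x := by
  rw [plane_apply]
  exact (Quaternion.coe_commute _ _).add_left (hx.smul_left _)

theorem star_imaginaryUnit (i : ImaginaryUnit) : star (i : ℍ) = -(i : ℍ) := by
  ext <;> simp [i.2.1]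

theorem star_plane (i : ImaginaryUnit) (ζ : ℂ) : star (plane i ζ) = plane i (conj ζ) := by
  rw [plane_apply, plane_apply, star_add, Quaternion.star_coe, Quaternion.star_smul,
    star_imaginaryUnit, Complex.conj_re, Complex.conj_im, smul_neg, neg_smul]

theorem exists_plane_eq (i : ImaginaryUnit) (x : ℍ) :
    ∃ (I : ImaginaryUnit) (ζ : ℂ), plane I ζ = x := by
  rcases eq_or_ne x.im 0 with h | h
  · refine ⟨i, x.re, ?_⟩
    rw [plane_ofReal, ← Quaternion.re_add_im x, h]
    simp
  · have hn := norm_ne_zero_iff.2 h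
    refine ⟨⟨‖x.im‖⁻¹ • x.im, by simp, ?_⟩, ⟨x.re, ‖x.im‖⟩, ?_⟩
    · rw [norm_smul, norm_inv, norm_norm, inv_mul_cancel₀ hn]
    · rw [plane_apply, smul_smul, mul_inv_cancel₀ hn, one_smul, Quaternion.re_add_im]

/-- The real linear projection of `ℍ` to `ℂ_i ≅ ℂ`, that is, `coord i`. -/
def coordL (i : ImaginaryUnit) : ℍ →L[ℝ] ℂ :=
  LinearMap.toContinuousLinearMap
    { toFun := coord i
      map_add' := fun x y => by
        apply Complex.ext <;> simp [coord, inner_add_right]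
      map_smul' := fun c x => by
        apply Complex.ext <;> simp [coord, inner_smul_right] }

theorem coordL_apply (x : ℍ) : coordL i x = coord i x := rfl

theorem coordL_imaginaryUnit_mul (x : ℍ) :
    coordL i ((i : ℍ) * x) = Complex.I * coordL i x := by
  have hre := i.2.1
  have hnorm : (i : ℍ).imI ^ 2 + (i : ℍ).imJ ^ 2 + (i : ℍ).imK ^ 2 = 1 := by
    have h := Quaternion.normSq_def' (a := (i : ℍ))
    rwa [Quaternion.normSq_eq_norm_mul_self, i.2.2, hre, one_mul, zero_pow two_ne_zero, zero_add,
      eq_comm] at h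
  apply Complex.ext
  · simp only [coordL_apply, coord, Quaternion.inner_def, Quaternion.re_mul, Quaternion.re_star,
      Quaternion.imI_star, Quaternion.imJ_star, Quaternion.imK_star, Complex.I_mul_re, hre]
    ring
  · simp only [coordL_apply, coord, Quaternion.inner_def, Quaternion.re_mul, Quaternion.imI_mul,
      Quaternion.imJ_mul, Quaternion.imK_mul, Quaternion.re_star, Quaternion.imI_star,
      Quaternion.imJ_star, Quaternion.imK_star, Complex.I_mul_im, hre]
    linear_combination x.re * hnorm

theorem coordL_plane_mul (ζ : ℂ) (x : ℍ) : coordL i (plane i ζ * x) = ζ * coordL i x := by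
  rw [plane_apply, add_mul, smul_mul_assoc, Quaternion.coe_mul_eq_smul, map_add, map_smul,
    map_smul, coordL_imaginaryUnit_mul, Complex.real_smul, Complex.real_smul, ← mul_assoc,
    ← add_mul, Complex.re_add_im]

theorem coord_plane (i : ImaginaryUnit) (ζ : ℂ) : coord i (plane i ζ) = ζ := by
  have hone : coordL i 1 = 1 := by
    apply Complex.ext <;> simp [coordL_apply, coord, Quaternion.inner_def, i.2.1]
  rw [← coordL_apply, ← mul_one (plane i ζ), coordL_plane_mul, hone, mul_one]

theorem plane_coord (w : sliceDisc i) : plane i (coord i w) = w := by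
  obtain ⟨_, _, ζ, rfl⟩ := w
  rw [coord_plane]

theorem eq_of_coordL_mul_right_eq {x y : ℍ} (h : ∀ q, coordL i (x * q) = coordL i (y * q)) :
    x = y := by
  have hnorm : coordL i ((x - y) * star (x - y)) = 0 := by
    rw [sub_mul, map_sub, sub_eq_zero, h]
  rw [Quaternion.self_mul_star] at hnorm
  exact sub_eq_zero.1 (Quaternion.normSq_eq_zero.1 (congrArg Complex.re hnorm))

theorem IsHolomorphic.differentiableOn_coordL_mul {g : ℂ → ℍ} (hg : IsHolomorphic i g) (q : ℍ) :
    DifferentiableOn ℂ (fun ζ => coordL i (g ζ * q)) (Metric.ball 0 1) := by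
  intro ζ hζ
  obtain ⟨p, hp⟩ := hg ζ (mem_ball_zero_iff.1 hζ)
  have hreal : HasFDerivAt (fun ζ => coordL i (g ζ * q)) _ ζ :=
    (coordL i).hasFDerivAt.comp ζ (hp.mul_const' q)
  refine (hasFDerivAt_of_restrictScalars ℝ (f' := ContinuousLinearMap.toSpanSingleton ℂ
    (coordL i (p * q))) hreal ?_).differentiableAt.differentiableWithinAt
  refine ContinuousLinearMap.ext fun h => ?_
  change h * coordL i (p * q) = coordL i (plane i h * p * q)
  rw [mul_assoc, coordL_plane_mul]

theorem IsHolomorphic.imaginaryUnit_mul {g : ℂ → ℍ} (hg : IsHolomorphic i g) :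
    IsHolomorphic i fun ζ => (i : ℍ) * g ζ := by
  intro ζ hζ
  obtain ⟨p, hp⟩ := hg ζ hζ
  refine ⟨(i : ℍ) * p, (hp.const_mul (i : ℍ)).congr_fderiv (ContinuousLinearMap.ext fun h => ?_)⟩
  change (i : ℍ) * (plane i h * p) = plane i h * ((i : ℍ) * p)
  rw [← mul_assoc, (commute_imaginaryUnit_plane i h).eq, mul_assoc]

end Slice

section BergmanSpace

variable {i : ImaginaryUnit} {α : ℝ}

/-- The restriction of a function in the Bergman space to `𝔻_i`, as a function of the complex
coordinate on `ℂ_i`, extended by zero outside the unit disc. -/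
def restr (f : BergmanSpace i α) (ζ : ℂ) : ℍ := extendZero f (plane i ζ)

theorem restr_add (f g : BergmanSpace i α) (ζ : ℂ) : restr (f + g) ζ = restr f ζ + restr g ζ :=
  congrFun (extendZero_add f.1 g.1) _

theorem restr_smul (f : BergmanSpace i α) (q : ℍ) (ζ : ℂ) : restr (f <• q) ζ = restr f ζ * q :=
  congrFun (extendZero_smul (.op q) f.1) _

theorem restr_coord (f : BergmanSpace i α) (w : sliceDisc i) :
    restr f (coord i w) = f.1 ⟨w, w.2.1⟩ := by
  rw [restr, plane_coord, extendZero_of_mem]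

theorem memLp_restr (f : BergmanSpace i α) : MemLp (restr f) 2 (areaMeasure α) := f.2.2

theorem restr_ofSlice (g : ℂ → ℍ) (hg : IsHolomorphic i g) (hL : MemLp g 2 (areaMeasure α))
    {ζ : ℂ} (hζ : ‖ζ‖ < 1) : restr (ofSlice g hg hL) ζ = g ζ :=
  (extendZero_of_mem _ ((plane_mem_ball i ζ).2 hζ)).trans (sliceExt_plane_self i g ζ)

theorem restr_J (f : BergmanSpace i α) {ζ : ℂ} (hζ : ‖ζ‖ < 1) :
    restr (J f) ζ = (i : ℍ) * restr f ζ :=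
  restr_ofSlice _ _ _ hζ

theorem isHolomorphic_restr (f : BergmanSpace i α) : IsHolomorphic i (restr f) := by
  have hneg : restr f = fun ζ => -((i : ℍ) * ((i : ℍ) * restr f ζ)) := by
    funext ζ
    rw [← mul_assoc, i.mul_self, neg_one_mul, neg_neg]
  rw [hneg]
  intro ζ hζ
  obtain ⟨p, hp⟩ := (isHolomorphic_of_mem f).imaginaryUnit_mul ζ hζ
  refine ⟨-p, hp.neg.congr_fderiv (ContinuousLinearMap.ext fun h => ?_)⟩
  exact (mul_neg (plane i h) p).symm

theorem extendZero_plane (f : BergmanSpace i α) (I : ImaginaryUnit) {ζ : ℂ} (hζ : ‖ζ‖ < 1) :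
    extendZero f (plane I ζ) = sliceExt i (restr f) (plane I ζ) := by
  obtain ⟨-, a, b, hab⟩ := f.2.1
  obtain ⟨u, v⟩ := ζ
  obtain ⟨hI, ha, hb, -⟩ := hab I u v ((plane_mem_ball I _).2 hζ)
  have hpos : restr f ⟨u, v⟩ = a u v + (i : ℍ) * b u v :=
    (hab i u v ((plane_mem_ball i _).2 hζ)).1
  have hneg : restr f ⟨u, -v⟩ = a u v - (i : ℍ) * b u v := by
    rw [restr, (hab i u (-v) ((plane_mem_ball i _).2 ((norm_mk_neg u v).trans_lt hζ))).1, ha, hb,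
      mul_neg, sub_eq_add_neg]
  have hsum : restr f ⟨u, v⟩ + restr f ⟨u, -v⟩ = (2 : ℝ) • a u v := by
    rw [hpos, hneg]
    module
  have hdiff : -((i : ℍ) * (restr f ⟨u, v⟩ - restr f ⟨u, -v⟩)) = (2 : ℝ) • b u v := by
    rw [hpos, hneg, add_sub_sub_cancel, ← two_smul ℝ, mul_smul_comm, ← mul_assoc, i.mul_self,
      neg_one_mul, smul_neg, neg_neg]
  rw [sliceExt_plane, hsum, hdiff, inv_smul_smul₀ two_ne_zero, inv_smul_smul₀ two_ne_zero, hI]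

theorem eq_of_restr_eq {f g : BergmanSpace i α} (h : ∀ ζ, ‖ζ‖ < 1 → restr f ζ = restr g ζ) :
    f = g := by
  have hrestr : restr f = restr g := by
    funext ζ
    by_cases hζ : plane i ζ ∈ ball
    · exact h ζ ((plane_mem_ball i ζ).1 hζ)
    · rw [restr, restr, extendZero, extendZero, dif_neg hζ, dif_neg hζ]
  refine Subtype.ext (funext fun x => ?_)
  obtain ⟨I, ζ, hx⟩ := exists_plane_eq i x
  have hζ : ‖ζ‖ < 1 := (plane_mem_ball I ζ).1 (hx ▸ x.2)
  rw [← extendZero_of_mem f.1 x.2, ← extendZero_of_mem g.1 x.2, ← hx, extendZero_plane f I hζ,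
    extendZero_plane g I hζ, hrestr]

theorem J_smul (f : BergmanSpace i α) (q : ℍ) : J (f <• q) = J f <• q :=
  eq_of_restr_eq fun ζ hζ => by
    rw [restr_J _ hζ, restr_smul, restr_smul, restr_J _ hζ, mul_assoc]

theorem J_add (f g : BergmanSpace i α) : J (f + g) = J f + J g :=
  eq_of_restr_eq fun ζ hζ => by
    rw [restr_J _ hζ, restr_add, restr_add, restr_J _ hζ, restr_J _ hζ, mul_add]

theorem J_sub (f g : BergmanSpace i α) : J (f - g) = J f - J g := by
  rw [eq_sub_iff_add_eq, ← J_add, sub_add_cancel]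

theorem integrable_star_restr_mul_restr (f g : BergmanSpace i α) :
    Integrable (fun z => star (restr f z) * restr g z) (areaMeasure α) :=
  (memLp_restr f).star.integrable_mul (memLp_restr g)

theorem scalarProduct_eq_integral (f g : BergmanSpace i α) :
    scalarProduct f g = ∫ z, star (restr f z) * restr g z ∂(areaMeasure α) := rfl

theorem star_scalarProduct (f g : BergmanSpace i α) :
    star (scalarProduct f g) = scalarProduct g f := by
  rw [scalarProduct_eq_integral, scalarProduct_eq_integral]
  let starL : ℍ →L[ℝ] ℍ := (starAddEquiv : ℍ ≃+ ℍ).toAddMonoidHom.toRealLinearMap continuous_star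
  refine (starL.integral_comp_comm (integrable_star_restr_mul_restr f g)).symm.trans ?_
  refine integral_congr_ae (.of_forall fun z => ?_)
  exact (star_mul _ _).trans (congrArg _ (star_star _))

theorem re_scalarProduct_self (f : BergmanSpace i α) :
    (scalarProduct f f).re = ∫ z, ‖restr f z‖ ^ 2 ∂(areaMeasure α) := by
  have hself : ∀ z, star (restr f z) * restr f z = (‖restr f z‖ ^ 2) • (1 : ℍ) := fun z => by
    rw [Quaternion.star_mul_self, Quaternion.normSq_eq_norm_mul_self, ← sq,
      ← Quaternion.coe_mul_eq_smul, mul_one]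
  rw [scalarProduct_eq_integral]
  simp only [hself]
  rw [integral_smul_const, Quaternion.re_smul, Quaternion.re_one, smul_eq_mul, mul_one]

theorem isHermitianForm_scalarProduct :
    IsHermitianForm (scalarProduct : BergmanSpace i α → BergmanSpace i α → ℍ) where
  add_right f g h := by
    simp only [scalarProduct_eq_integral, restr_add, mul_add]
    exact integral_add (integrable_star_restr_mul_restr f g) (integrable_star_restr_mul_restr f h)
  smul_right f g q := by
    simp only [scalarProduct_eq_integral, restr_smul, ← mul_assoc]
    exact integral_mul_const_of_integrable (integrable_star_restr_mul_restr f g)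
  star_apply := star_scalarProduct
  re_self_nonneg f := by
    rw [re_scalarProduct_self]
    exact integral_nonneg fun _ => sq_nonneg _

theorem bergmanNorm_eq_formNorm (f : BergmanSpace i α) :
    bergmanNorm f = formNorm scalarProduct f := by
  rw [formNorm, re_scalarProduct_self]
  rfl

theorem scalarProduct_J_J (f g : BergmanSpace i α) :
    scalarProduct (J f) (J g) = scalarProduct f g := by
  refine integral_congr_ae ?_
  filter_upwards [ae_areaMeasure_norm_lt α] with z hz
  change star (restr (J f) z) * restr (J g) z = star (restr f z) * restr g z
  rw [restr_J f hz, restr_J g hz, star_mul, star_imaginaryUnit, mul_assoc, ← mul_assoc (-(i : ℍ)),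
    neg_mul, i.mul_self, neg_neg, one_mul]

theorem scalarProduct_J_right {a : BergmanSpace i α} (ha : J a = a <• (i : ℍ))
    (f : BergmanSpace i α) : scalarProduct a (J f) = (i : ℍ) * scalarProduct a f := by
  rw [← scalarProduct_J_J a f, ha, isHermitianForm_scalarProduct.smul_left, star_imaginaryUnit,
    ← mul_assoc, mul_neg, i.mul_self, neg_neg, one_mul]

end BergmanSpace

section BoundedOperators

variable {i : ImaginaryUnit} {α : ℝ} {T : BergmanSpace i α →ₗ[ℍᵐᵒᵖ] BergmanSpace i α}

theorem bergmanNorm_nonneg (f : BergmanSpace i α) : 0 ≤ bergmanNorm f := Real.sqrt_nonneg _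

theorem operatorNorm_nonneg (T : BergmanSpace i α →ₗ[ℍᵐᵒᵖ] BergmanSpace i α) :
    0 ≤ operatorNorm T :=
  Real.sSup_nonneg fun _ ⟨_, _, hr⟩ => hr ▸ bergmanNorm_nonneg _

theorem bergmanNorm_le_operatorNorm_mul {C : ℝ}
    (hT : ∀ f, bergmanNorm (T f) ≤ C * bergmanNorm f) (f : BergmanSpace i α) :
    bergmanNorm (T f) ≤ operatorNorm T * bergmanNorm f := by
  rcases (bergmanNorm_nonneg f).eq_or_lt with h | hpos
  · simpa only [← h, mul_zero] using hT f
  have hsmul : ∀ g : BergmanSpace i α, bergmanNorm (g <• (((bergmanNorm f)⁻¹ : ℝ) : ℍ)) =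
      bergmanNorm g / bergmanNorm f := fun g => by
    rw [bergmanNorm_eq_formNorm (g <• _), isHermitianForm_scalarProduct.formNorm_smul,
      ← bergmanNorm_eq_formNorm, Quaternion.norm_coe, Real.norm_of_nonneg (inv_nonneg.2 hpos.le),
      div_eq_mul_inv]
  have hbdd : BddAbove {r : ℝ | ∃ g : BergmanSpace i α, bergmanNorm g = 1 ∧
      r = bergmanNorm (T g)} := by
    refine ⟨C, ?_⟩
    rintro _ ⟨g, hg, rfl⟩
    simpa only [hg, mul_one] using hT g
  rw [← div_le_iff₀ hpos, ← hsmul, ← map_smul]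
  exact le_csSup hbdd ⟨_, by rw [hsmul, div_self hpos.ne'], rfl⟩

theorem operatorNorm_eq_of_bound_of_attained {M : ℝ}
    (hT : ∀ f, bergmanNorm (T f) ≤ M * bergmanNorm f)
    {a : BergmanSpace i α} (ha : bergmanNorm a = 1) (haM : bergmanNorm (T a) = M) :
    operatorNorm T = M := by
  refine IsGreatest.csSup_eq ⟨⟨a, ha, haM.symm⟩, ?_⟩
  rintro _ ⟨f, hf, rfl⟩
  simpa only [hf, mul_one] using hT f

theorem commute_scalarProduct_map (hT : T ∈ commutantJ i α) {a : BergmanSpace i α}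
    (ha : J a = a <• (i : ℍ)) : Commute (i : ℍ) (scalarProduct a (T a)) := by
  rw [Commute, SemiconjBy, ← scalarProduct_J_right ha, ← hT.2, ha, map_smul,
    isHermitianForm_scalarProduct.smul_right]

theorem norm_scalarProduct_map_sub_le (hT : T ∈ commutantJ i α) {a b : BergmanSpace i α}
    (ha : bergmanNorm a = 1) (hb : bergmanNorm b = 1) (hJ : J b = b <• (i : ℍ)) {γ : ℂ}
    (hab : scalarProduct a b = plane i γ) :
    ‖scalarProduct a (T a) - scalarProduct b (T b)‖ ≤
      2 * operatorNorm T * √(1 - ‖scalarProduct a b‖ ^ 2) := by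
  rw [bergmanNorm_eq_formNorm] at ha hb
  refine isHermitianForm_scalarProduct.norm_apply_map_sub_le T (fun f => ?_) ha hb ?_
  · obtain ⟨⟨C, hC⟩, -⟩ := hT
    rw [← bergmanNorm_eq_formNorm, ← bergmanNorm_eq_formNorm]
    exact bergmanNorm_le_operatorNorm_mul hC f
  · rw [hab]
    exact commute_plane_of_commute (commute_scalarProduct_map hT hJ) γ

theorem projDiff_mem_commutantJ {a b : BergmanSpace i α} (ha : bergmanNorm a = 1)
    (hb : bergmanNorm b = 1) (hJa : J a = a <• (i : ℍ)) (hJb : J b = b <• (i : ℍ)) :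
    isHermitianForm_scalarProduct.projDiff a b ∈ commutantJ i α := by
  rw [bergmanNorm_eq_formNorm] at ha hb
  refine ⟨⟨√(1 - ‖scalarProduct a b‖ ^ 2), fun f => ?_⟩, fun f => ?_⟩
  · rw [bergmanNorm_eq_formNorm, bergmanNorm_eq_formNorm]
    exact isHermitianForm_scalarProduct.formNorm_projDiff_le ha hb f
  · rw [IsHermitianForm.projDiff_apply, IsHermitianForm.projDiff_apply, J_sub, J_smul, J_smul, hJa,
      hJb, scalarProduct_J_right hJa, scalarProduct_J_right hJb, MulOpposite.op_mul,
      MulOpposite.op_mul, mul_smul, mul_smul]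

theorem operatorNorm_projDiff {a b : BergmanSpace i α} (ha : bergmanNorm a = 1)
    (hb : bergmanNorm b = 1) :
    operatorNorm (isHermitianForm_scalarProduct.projDiff a b) =
      √(1 - ‖scalarProduct a b‖ ^ 2) := by
  have ha' := (bergmanNorm_eq_formNorm a).symm.trans ha
  have hb' := (bergmanNorm_eq_formNorm b).symm.trans hb
  refine operatorNorm_eq_of_bound_of_attained (fun f => ?_) ha ?_
  · rw [bergmanNorm_eq_formNorm, bergmanNorm_eq_formNorm]
    exact isHermitianForm_scalarProduct.formNorm_projDiff_le ha' hb' f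
  · rw [bergmanNorm_eq_formNorm]
    exact isHermitianForm_scalarProduct.formNorm_projDiff_left ha' hb'

end BoundedOperators

section BerezinTransform

variable {i : ImaginaryUnit} {α : ℝ}

theorem restr_kernel (hα : -1 < α) (w : sliceDisc i) {ζ : ℂ} (hζ : ‖ζ‖ < 1) :
    restr (kernel hα w) ζ = plane i (complexKernel α ζ (coord i w)) :=
  restr_ofSlice _ _ _ hζ

theorem scalarProduct_kernel (hα : -1 < α) (w : sliceDisc i) (f : BergmanSpace i α) :
    scalarProduct (kernel hα w) f = restr f (coord i w) := by
  refine eq_of_coordL_mul_right_eq (i := i) fun q => ?_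
  have hint := integrable_star_restr_mul_restr (kernel hα w) f
  have hcoord : (fun z => coordL i (star (restr (kernel hα w) z) * restr f z * q))
      =ᵐ[areaMeasure α]
        fun z => conj (complexKernel α z (coord i w)) • coordL i (restr f z * q) := by
    filter_upwards [ae_areaMeasure_norm_lt α] with z hz
    rw [restr_kernel hα w hz, star_plane, mul_assoc, coordL_plane_mul, smul_eq_mul]
  rw [scalarProduct_eq_integral, ← integral_mul_const_of_integrable hint,
    ← (coordL i).integral_comp_comm (hint.mul_const q), integral_congr_ae hcoord]
  exact integral_conj_complexKernel_smul hα (norm_coord_lt w)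
    ((isHolomorphic_restr f).differentiableOn_coordL_mul q)
    (((coordL i).integrable_comp (hint.mul_const q)).congr hcoord)

theorem J_kernel (hα : -1 < α) (w : sliceDisc i) :
    J (kernel hα w) = kernel hα w <• (i : ℍ) :=
  eq_of_restr_eq fun ζ hζ => by
    rw [restr_J _ hζ, restr_smul, restr_kernel hα w hζ, (commute_imaginaryUnit_plane i _).eq]

theorem scalarProduct_kernel_kernel (hα : -1 < α) (z w : sliceDisc i) :
    scalarProduct (kernel hα z) (kernel hα w) =
      plane i (complexKernel α (coord i z) (coord i w)) := by
  rw [scalarProduct_kernel, restr_kernel hα w (norm_coord_lt z)]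

theorem bergmanNorm_kernel_sq (hα : -1 < α) (w : sliceDisc i) :
    bergmanNorm (kernel hα w) ^ 2 = ((1 - ‖coord i w‖ ^ 2) ^ (2 + α))⁻¹ := by
  have hpos := one_sub_norm_sq_pos (norm_coord_lt w)
  have hself : (scalarProduct (kernel hα w) (kernel hα w)).re =
      ((1 - ‖coord i w‖ ^ 2) ^ (2 + α))⁻¹ := by
    rw [scalarProduct_kernel_kernel, complexKernel_self α (norm_coord_lt w), plane_ofReal,
      Quaternion.re_coe]
  rw [bergmanNorm_eq_formNorm, formNorm, hself, Real.sq_sqrt (by positivity)]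

theorem bergmanNorm_kernel_pos (hα : -1 < α) (w : sliceDisc i) : 0 < bergmanNorm (kernel hα w) := by
  have hpos := one_sub_norm_sq_pos (norm_coord_lt w)
  have hsq : 0 < bergmanNorm (kernel hα w) ^ 2 := by
    rw [bergmanNorm_kernel_sq]
    positivity
  exact (bergmanNorm_nonneg _).lt_of_ne' (sq_pos_iff.1 hsq)

theorem bergmanNorm_normalizedKernel (hα : -1 < α) (w : sliceDisc i) :
    bergmanNorm (normalizedKernel hα w) = 1 := by
  have hpos := bergmanNorm_kernel_pos hα w
  rw [normalizedKernel, bergmanNorm_eq_formNorm, isHermitianForm_scalarProduct.formNorm_smul,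
    ← bergmanNorm_eq_formNorm, Quaternion.norm_coe, Real.norm_of_nonneg (inv_nonneg.2 hpos.le),
    mul_inv_cancel₀ hpos.ne']

theorem J_normalizedKernel (hα : -1 < α) (w : sliceDisc i) :
    J (normalizedKernel hα w) = normalizedKernel hα w <• (i : ℍ) := by
  rw [normalizedKernel, J_smul, J_kernel, smul_smul, smul_smul, ← MulOpposite.op_mul,
    ← MulOpposite.op_mul, Quaternion.coe_commutes]

theorem scalarProduct_normalizedKernel (hα : -1 < α) (z w : sliceDisc i) :
    scalarProduct (normalizedKernel hα z) (normalizedKernel hα w) =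
      plane i (((bergmanNorm (kernel hα z))⁻¹ * (bergmanNorm (kernel hα w))⁻¹ : ℝ) *
        complexKernel α (coord i z) (coord i w)) := by
  rw [normalizedKernel, normalizedKernel, isHermitianForm_scalarProduct.smul_left,
    isHermitianForm_scalarProduct.smul_right, scalarProduct_kernel_kernel, map_mul, plane_ofReal,
    Quaternion.star_coe, ← Quaternion.coe_commutes, ← mul_assoc, ← Quaternion.coe_mul, mul_comm]

theorem pseudoHyperbolic_eq_norm_mobius (z w : sliceDisc i) :
    pseudoHyperbolic z w = ‖mobius (coord i w) (coord i z)‖ := by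
  have hsub : (z : ℍ) - w = plane i (coord i z - coord i w) := by
    rw [map_sub, plane_coord, plane_coord]
  have hone_sub : 1 - (z : ℍ) * star (w : ℍ) = plane i (1 - coord i z * conj (coord i w)) := by
    rw [map_sub, map_mul, map_one, ← star_plane, plane_coord, plane_coord]
  rw [pseudoHyperbolic, hsub, hone_sub, norm_plane, norm_plane, norm_sub_rev, mobius, norm_div]

theorem norm_scalarProduct_normalizedKernel_sq (hα : -1 < α) (z w : sliceDisc i) :
    ‖scalarProduct (normalizedKernel hα z) (normalizedKernel hα w)‖ ^ 2 =
      (1 - pseudoHyperbolic z w ^ 2) ^ (2 + α) := by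
  have hz := one_sub_norm_sq_pos (norm_coord_lt z)
  have hw := one_sub_norm_sq_pos (norm_coord_lt w)
  rw [pseudoHyperbolic_eq_norm_mobius, one_sub_norm_mobius_sq (norm_coord_lt z) (norm_coord_lt w),
    Real.div_rpow (by positivity) (by positivity), Real.mul_rpow hw.le hz.le,
    ← Real.rpow_pow_comm (norm_nonneg _), scalarProduct_normalizedKernel, norm_plane, norm_mul,
    norm_complexKernel, Complex.norm_real, norm_mul, norm_inv, norm_inv,
    Real.norm_of_nonneg (bergmanNorm_nonneg _), Real.norm_of_nonneg (bergmanNorm_nonneg _),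
    mul_pow, mul_pow, inv_pow, inv_pow, inv_pow, bergmanNorm_kernel_sq, bergmanNorm_kernel_sq,
    inv_inv, inv_inv, mul_comm ((1 - ‖coord i z‖ ^ 2) ^ (2 + α)), ← div_eq_mul_inv]

theorem sqrt_one_sub_rpow_le {p t : ℝ} (hp : 1 ≤ p) (h0 : 0 ≤ t) (h1 : t ≤ 1) :
    √(1 - (1 - t ^ 2) ^ p) ≤ √p * t := by
  have hbernoulli := one_add_mul_self_le_rpow_one_add
    (neg_le_neg (pow_le_one₀ h0 h1 : t ^ 2 ≤ 1)) hp
  rw [← sub_eq_add_neg] at hbernoulli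
  rw [← Real.sqrt_sq h0, ← Real.sqrt_mul (zero_le_one.trans hp), Real.sqrt_sq h0]
  exact Real.sqrt_le_sqrt (by linarith)

theorem norm_berezin_sub_le (hα : -1 < α) {T : BergmanSpace i α →ₗ[ℍᵐᵒᵖ] BergmanSpace i α}
    (hT : T ∈ commutantJ i α) (z w : sliceDisc i) :
    ‖berezin hα T z - berezin hα T w‖ ≤
      2 * √(2 + α) * operatorNorm T * pseudoHyperbolic z w := by
  have hρ : 0 ≤ pseudoHyperbolic (z : ℍ) w := by
    rw [pseudoHyperbolic_eq_norm_mobius]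
    exact norm_nonneg _
  have hρ' : pseudoHyperbolic (z : ℍ) w ≤ 1 := by
    rw [pseudoHyperbolic_eq_norm_mobius]
    exact (norm_mobius_lt_one (norm_coord_lt z) (norm_coord_lt w)).le
  have hnorm := operatorNorm_nonneg T
  calc ‖berezin hα T z - berezin hα T w‖
      ≤ 2 * operatorNorm T * √(1 - (1 - pseudoHyperbolic z w ^ 2) ^ (2 + α)) := by
        rw [← norm_scalarProduct_normalizedKernel_sq hα]
        exact norm_scalarProduct_map_sub_le hT (bergmanNorm_normalizedKernel hα z)
          (bergmanNorm_normalizedKernel hα w) (J_normalizedKernel hα w)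
          (scalarProduct_normalizedKernel hα z w)
    _ ≤ 2 * operatorNorm T * (√(2 + α) * pseudoHyperbolic z w) := by
        gcongr
        exact sqrt_one_sub_rpow_le (by linarith) hρ hρ'
    _ = 2 * √(2 + α) * operatorNorm T * pseudoHyperbolic z w := by ring

/-- The difference of the orthogonal projections to `k_z ℍ` and `k_w ℍ`, which is extremal for the
Lipschitz estimate. -/
def kernelProjDiff (hα : -1 < α) (z w : sliceDisc i) :
    BergmanSpace i α →ₗ[ℍᵐᵒᵖ] BergmanSpace i α :=
  isHermitianForm_scalarProduct.projDiff (normalizedKernel hα z) (normalizedKernel hα w)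

theorem kernelProjDiff_mem_commutantJ (hα : -1 < α) (z w : sliceDisc i) :
    kernelProjDiff hα z w ∈ commutantJ i α :=
  projDiff_mem_commutantJ (bergmanNorm_normalizedKernel hα z) (bergmanNorm_normalizedKernel hα w)
    (J_normalizedKernel hα z) (J_normalizedKernel hα w)

theorem operatorNorm_kernelProjDiff (hα : -1 < α) (z w : sliceDisc i) :
    operatorNorm (kernelProjDiff hα z w) =
      √(1 - (1 - pseudoHyperbolic z w ^ 2) ^ (2 + α)) := by
  rw [← norm_scalarProduct_normalizedKernel_sq hα]
  exact operatorNorm_projDiff (bergmanNorm_normalizedKernel hα z)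
    (bergmanNorm_normalizedKernel hα w)

theorem berezin_kernelProjDiff_sub (hα : -1 < α) (z w : sliceDisc i) :
    berezin hα (kernelProjDiff hα z w) z - berezin hα (kernelProjDiff hα z w) w =
      ((2 * (1 - (1 - pseudoHyperbolic z w ^ 2) ^ (2 + α)) : ℝ) : ℍ) := by
  rw [← norm_scalarProduct_normalizedKernel_sq hα]
  exact isHermitianForm_scalarProduct.apply_projDiff_sub_apply_projDiff
    ((bergmanNorm_eq_formNorm _).symm.trans (bergmanNorm_normalizedKernel hα z))
    ((bergmanNorm_eq_formNorm _).symm.trans (bergmanNorm_normalizedKernel hα w))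

theorem two_mul_sqrt_le_of_forall_norm_berezin_sub_le (hα : -1 < α) {C : ℝ}
    (hC : ∀ T ∈ commutantJ i α, ∀ z w : sliceDisc i,
      ‖berezin hα T z - berezin hα T w‖ ≤ C * operatorNorm T * pseudoHyperbolic z w)
    {z w : sliceDisc i} (hρ : 0 < pseudoHyperbolic (z : ℍ) w) :
    2 * √(1 - (1 - pseudoHyperbolic z w ^ 2) ^ (2 + α)) ≤ C * pseudoHyperbolic z w := by
  have hpos : 0 < 1 - (1 - pseudoHyperbolic z w ^ 2) ^ (2 + α) := by
    have hlt : pseudoHyperbolic (z : ℍ) w ^ 2 < 1 := by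
      rw [pseudoHyperbolic_eq_norm_mobius, sq_lt_one_iff₀ (norm_nonneg _)]
      exact norm_mobius_lt_one (norm_coord_lt z) (norm_coord_lt w)
    exact sub_pos.2 (Real.rpow_lt_one (sub_pos.2 hlt).le (sub_lt_self _ (pow_pos hρ 2))
      (by linarith))
  have hle := hC _ (kernelProjDiff_mem_commutantJ hα z w) z w
  rw [berezin_kernelProjDiff_sub, operatorNorm_kernelProjDiff, Quaternion.norm_coe,
    Real.norm_of_nonneg (by positivity)] at hle
  refine le_of_mul_le_mul_right ?_ (Real.sqrt_pos.2 hpos)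
  rwa [mul_assoc, Real.mul_self_sqrt hpos.le, mul_right_comm]

theorem exists_pseudoHyperbolic_eq (i : ImaginaryUnit) {t : ℝ} (h0 : 0 ≤ t) (h1 : t < 1) :
    ∃ z w : sliceDisc i, pseudoHyperbolic (z : ℍ) w = t := by
  have hnorm : ‖(t : ℂ)‖ = t := by rw [Complex.norm_real, Real.norm_of_nonneg h0]
  let point (ζ : ℂ) (hζ : ‖ζ‖ < 1) : sliceDisc i :=
    ⟨plane i ζ, (plane_mem_ball i ζ).2 hζ, ζ, rfl⟩
  refine ⟨point 0 (by simp), point t (hnorm.trans_lt h1), ?_⟩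
  rw [pseudoHyperbolic_eq_norm_mobius, coord_plane, coord_plane, mobius_zero, hnorm]

theorem tendsto_one_sub_rpow_div (p : ℝ) :
    Tendsto (fun x : ℝ => (1 - (1 - x) ^ p) / x) (𝓝[>] 0) (𝓝 p) := by
  have hderiv : HasDerivAt (fun x : ℝ => -(1 - x) ^ p) p 0 := by
    simpa using (((hasDerivAt_id (0 : ℝ)).const_sub 1).rpow_const (p := p) (by simp)).fun_neg
  refine hderiv.tendsto_slope_zero_right.congr fun x => ?_
  rw [zero_add, sub_zero, Real.one_rpow, smul_eq_mul]
  ring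

theorem two_mul_sqrt_le_lipschitz_constant (hα : -1 < α) {C : ℝ}
    (hC : ∀ T ∈ commutantJ i α, ∀ z w : sliceDisc i,
      ‖berezin hα T z - berezin hα T w‖ ≤ C * operatorNorm T * pseudoHyperbolic z w) :
    2 * √(2 + α) ≤ C := by
  have hlim := ((tendsto_one_sub_rpow_div (2 + α)).sqrt).const_mul 2
  refine le_of_tendsto hlim ?_
  filter_upwards [Ioo_mem_nhdsGT zero_lt_one] with x ⟨h0, h1⟩
  have hsqrt := Real.sqrt_pos.2 h0
  obtain ⟨z, w, hzw⟩ := exists_pseudoHyperbolic_eq i hsqrt.le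
    ((Real.sqrt_lt' one_pos).2 (by rwa [one_pow]))
  have hle := two_mul_sqrt_le_of_forall_norm_berezin_sub_le hα hC (hzw ▸ hsqrt)
  rw [hzw, Real.sq_sqrt h0.le] at hle
  rwa [Real.sqrt_div' _ h0.le, mul_div_assoc', div_le_iff₀ hsqrt]

end BerezinTransform

end SliceBergman

end

theorem mainTheorem6 (i : SliceBergman.ImaginaryUnit) (α : ℝ) (hα : -1 < α) :
    (∀ (w : SliceBergman.sliceDisc i) (f : SliceBergman.BergmanSpace i α),
      SliceBergman.scalarProduct (SliceBergman.kernel hα w) f = f.1 ⟨w, w.2.1⟩) ∧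
    (∀ T ∈ SliceBergman.commutantJ i α, ∀ z w : SliceBergman.sliceDisc i,
      ‖SliceBergman.berezin hα T z - SliceBergman.berezin hα T w‖ ≤
        2 * Real.sqrt (2 + α) * SliceBergman.operatorNorm T *
          SliceBergman.pseudoHyperbolic z w) ∧
    (∀ C : ℝ,
      (∀ T ∈ SliceBergman.commutantJ i α, ∀ z w : SliceBergman.sliceDisc i,
        ‖SliceBergman.berezin hα T z - SliceBergman.berezin hα T w‖ ≤
          C * SliceBergman.operatorNorm T * SliceBergman.pseudoHyperbolic z w) →
      2 * Real.sqrt (2 + α) ≤ C) := by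
  refine ⟨fun w f => ?_, fun T hT z w => SliceBergman.norm_berezin_sub_le hα hT z w,
    fun C hC => SliceBergman.two_mul_sqrt_le_lipschitz_constant hα hC⟩
  rw [SliceBergman.scalarProduct_kernel, SliceBergman.restr_coord]
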